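/- Let $\Delta$ be the closed disk of radius $\sqrt2$ centred at the origin of the $xy$-plane. A *tangle shadow* $U$ consists of two arcs in $\Delta$ (continuous parametrized curves, possibly self-crossing): $L$ from $(-1,-1)$ to $(-1,1)$ and $R$ from $(1,-1)$ to $(1,1)$, forming a regular projection: there are only finitely many multiple points, all of them double points and none of them an endpoint of an arc, and at each double point the two branches have linearly independent tangent vectors (in particular there are no triple points and no tangencies). For an even integer $m\ge 2$, $U$ *has rank $m$* (respectively, *has rank $-m$*) if there are $m$ crossings between $L$ and $R$ that are encountered in the order $1,\dots,m$ as $L$ is traversed from $(-1,-1)$ to $(-1,1)$, and in the order $1,\dots,m$ (respectively, in the reverse order $m,\dots,1$) as $R$ is traversed from $(1,-1)$ to $(1,1)$. A *tangle* $T$ is the disjoint union of two strings $\lambda,\rho$ (homeomorphic images of $[0,1]$) in $\Delta\times[0,3]$. It is *$z$-monotone* if for each $c\in[0,3]$ the plane $z=c$ meets each string in exactly one point. It is *of Type I* if $\lambda$ goes from $(-1,-1,0)$ to $(-1,1,3)$ and $\rho$ from $(1,-1,0)$ to $(1,1,3)$, and *of Type II* if $\lambda$ goes from $(-1,-1,0)$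 to $(-1,1,3)$ and $\rho$ from $(1,1,0)$ to $(1,-1,3)$. $U$ is *the shadow of $T$* if the projections of $\lambda$ and $\rho$ to the $xy$-plane are, up to reparametrization and direction, the arcs $L$ and $R$. The *braid diagram* of a $z$-monotone tangle $T$ is its projection to the vertical plane $y=2$, with over/under information at the crossings. The *linking index* $\mathrm{lk}(T)$ is half the sum of the signs of the crossings between the two strands of this diagram, both strands being directed by increasing $z$. If the vertical projection is not regular (infinitely many crossings, or strands that touch without crossing), it is first made regular by a sufficiently small perturbation of $T$ among $z$-monotone tangles with the same endpoints; the result does not depend on the perturbation. **Proposition.** Let $U$ be a tangle shadow, and let $m\ge 2$ be an even integer. If $U$ has rank $m$ (respectively, rank $-m$), then $U$ is the shadow of a $z$-monotone tangle $T$ of Type I (respectively, of Type II) such that $|\mathrm{lk}(T)|=m/2$. -/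

import Mathlib

open Set unitInterval

noncomputable section

/-- Points of 3-space, written as (horizontal position `(x, y)`, height `z`). -/
abbrev Space : Type := (ℝ × ℝ) × ℝ

/-- The closed disk `Δ` of radius `√2` centred at the origin of the `xy`-plane. -/
def disk : Set (ℝ × ℝ) := {p | p.1 ^ 2 + p.2 ^ 2 ≤ 2}

/-- The cylinder `Δ × [0, 3]`. -/
def cylinder : Set Space := disk ×ˢ Icc (0 : ℝ) 3

/-! ### Tangle shadows -/

/-- The parametrized pair of arcs `L`, `R` as one map; `(false, t)` stands for the point of
parameter `t` on `L`, and `(true, t)` for the point of parameter `t` on `R`. -/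
def arcPair (L R : ℝ → ℝ × ℝ) (q : Bool × ℝ) : ℝ × ℝ := if q.1 then R q.2 else L q.2

/-- The pairs of distinct parameters (on the same arc or on different arcs) with the same image. -/
def doublePoints (L R : ℝ → ℝ × ℝ) : Set ((Bool × ℝ) × (Bool × ℝ)) :=
  {d | d.1.2 ∈ Icc (0 : ℝ) 1 ∧ d.2.2 ∈ Icc (0 : ℝ) 1 ∧ d.1 ≠ d.2 ∧
    arcPair L R d.1 = arcPair L R d.2}

/-- A tangle shadow: an arc `L` from `(-1, -1)` to `(-1, 1)` and an arc `R` from `(1, -1)` to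
`(1, 1)` in the disk, which together form a regular system of plane curves. That is, there are
finitely many multiple points, no triple points, and at each double point (which is not an
endpoint of an arc) the two branches have tangent vectors that are linearly independent.
The arcs need not be smooth away from the double points, so smooth and polygonal regular
projections are both covered. Only the values of `L` and `R` on `[0, 1]` matter. -/
structure TangleShadow where
  L : ℝ → ℝ × ℝ
  R : ℝ → ℝ × ℝ
  continuousOn_L : ContinuousOn L (Icc 0 1)
  continuousOn_R : ContinuousOn R (Icc 0 1)
  L_mem : ∀ t ∈ Icc (0 : ℝ) 1, L t ∈ disk
  R_mem : ∀ t ∈ Icc (0 : ℝ) 1, R t ∈ disk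
  L_zero : L 0 = (-1, -1)
  L_one : L 1 = (-1, 1)
  R_zero : R 0 = (1, -1)
  R_one : R 1 = (1, 1)
  finite_doublePoints : (doublePoints L R).Finite
  no_triple : ∀ a b c : Bool × ℝ, (a, b) ∈ doublePoints L R → (a, c) ∈ doublePoints L R → b = c
  interior : ∀ a b : Bool × ℝ, (a, b) ∈ doublePoints L R → a.2 ∈ Ioo (0 : ℝ) 1
  transverse : ∀ a b : Bool × ℝ, (a, b) ∈ doublePoints L R →
    ∃ u v : ℝ × ℝ, HasDerivAt (fun t => arcPair L R (a.1, t)) u a.2 ∧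
      HasDerivAt (fun t => arcPair L R (b.1, t)) v b.2 ∧ u.1 * v.2 - u.2 * v.1 ≠ 0

/-- `U` has rank `m`: there are crossings `1, …, m` between `L` and `R` that are met in this
order along `L` from `(-1, -1)` to `(-1, 1)` and also along `R` from `(1, -1)` to `(1, 1)`. -/
def TangleShadow.HasRank (U : TangleShadow) (m : ℕ) : Prop :=
  ∃ t s : Fin m → ℝ, (∀ i, t i ∈ Icc (0 : ℝ) 1) ∧ (∀ i, s i ∈ Icc (0 : ℝ) 1) ∧
    (∀ i, U.L (t i) = U.R (s i)) ∧ StrictMono t ∧ StrictMono s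

/-- `U` has rank `-m`: there are crossings `1, …, m` between `L` and `R` that are met in this
order along `L`, and in the reverse order `m, …, 1` along `R`. -/
def TangleShadow.HasNegRank (U : TangleShadow) (m : ℕ) : Prop :=
  ∃ t s : Fin m → ℝ, (∀ i, t i ∈ Icc (0 : ℝ) 1) ∧ (∀ i, s i ∈ Icc (0 : ℝ) 1) ∧
    (∀ i, U.L (t i) = U.R (s i)) ∧ StrictMono t ∧ StrictAnti s

/-! ### Tangles -/

/-- A tangle: two disjoint strings (homeomorphic images of `[0, 1]`, given by injective continuous
parametrizations) in the cylinder. -/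
structure Tangle where
  lam : C(I, Space)
  rho : C(I, Space)
  lam_injective : Function.Injective lam
  rho_injective : Function.Injective rho
  lam_mem : ∀ u, lam u ∈ cylinder
  rho_mem : ∀ u, rho u ∈ cylinder
  disjoint : Disjoint (range lam) (range rho)

/-- Every plane `z = c` with `c ∈ [0, 3]` meets each string in exactly one point. -/
def Tangle.IsZMonotone (T : Tangle) : Prop :=
  ∀ c ∈ Icc (0 : ℝ) 3, (∃! p, p ∈ range T.lam ∧ p.2 = c) ∧ (∃! p, p ∈ range T.rho ∧ p.2 = c)

def Tangle.IsTypeI (T : Tangle) : Prop :=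
  T.lam 0 = ((-1, -1), 0) ∧ T.lam 1 = ((-1, 1), 3) ∧
    T.rho 0 = ((1, -1), 0) ∧ T.rho 1 = ((1, 1), 3)

def Tangle.IsTypeII (T : Tangle) : Prop :=
  T.lam 0 = ((-1, -1), 0) ∧ T.lam 1 = ((-1, 1), 3) ∧
    T.rho 0 = ((1, 1), 0) ∧ T.rho 1 = ((1, -1), 3)

/-- `U` is the shadow of `T`: up to reparametrization (possibly reversing the direction), the
projections of the strings of `T` to the `xy`-plane are the arcs of `U`. -/
def TangleShadow.IsShadowOf (U : TangleShadow) (T : Tangle) : Prop :=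
  (∃ φ : I ≃ₜ I, ∀ u, (T.lam u).1 = U.L (φ u)) ∧ (∃ ψ : I ≃ₜ I, ∀ u, (T.rho u).1 = U.R (ψ u))

/-! ### The braid diagram and the linking index -/

open Classical in
/-- The horizontal position `(x, y)` of the point at height `z` of a string (the point is unique
for a string of a `z`-monotone tangle). -/
def atHeight (s : C(I, Space)) (z : ℝ) : ℝ × ℝ :=
  if h : ∃ u, (s u).2 = z then (s h.choose).1 else 0

namespace Tangle

/-- The heights of the crossings of the vertical diagram, that is, of the projection to a plane
`y = const`, which retains the coordinates `x` and `z`. -/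
def verticalCrossings (T : Tangle) : Set ℝ :=
  {z ∈ Icc (0 : ℝ) 3 | (atHeight T.lam z).1 = (atHeight T.rho z).1}

/-- The graph of `a` crosses the graph of `b` from left (smaller values) to right at height `z`,
when both are traversed in the direction of increasing height. -/
def CrossesRight (a b : ℝ → ℝ) (z : ℝ) : Prop :=
  ∃ r > 0, (∀ w ∈ Ioo (z - r) z, a w < b w) ∧ (∀ w ∈ Ioo z (z + r), b w < a w)

/-- The vertical diagram of `T` is a regular braid diagram: there are finitely many crossings,
none of them an endpoint, and at each of them the two strands really cross (they do not merely
touch). -/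
def IsVerticallyRegular (T : Tangle) : Prop :=
  T.verticalCrossings.Finite ∧ ∀ z ∈ T.verticalCrossings, z ∈ Ioo (0 : ℝ) 3 ∧
    (CrossesRight (fun w => (atHeight T.lam w).1) (fun w => (atHeight T.rho w).1) z ∨
      CrossesRight (fun w => (atHeight T.rho w).1) (fun w => (atHeight T.lam w).1) z)

open Classical in
/-- The sign of a crossing of the braid diagram, both strands being directed upwards: it is `+1`
if the strand in front (the one with smaller `y`) goes from left to right, and `-1` if it goes
from right to left. -/
def crossingSign (T : Tangle) (z : ℝ) : ℚ :=
  (if (atHeight T.lam z).2 < (atHeight T.rho z).2 then 1 else -1) *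
    (if CrossesRight (fun w => (atHeight T.lam w).1) (fun w => (atHeight T.rho w).1) z
      then 1 else -1)

/-- The linking index of a regular braid diagram: half the sum of the signs of the crossings
between its two strands. -/
def diagramIndex (T : Tangle) : ℚ :=
  (1 / 2) * ∑ᶠ z ∈ T.verticalCrossings, T.crossingSign z

/-- `T'` is a `z`-monotone tangle with the same endpoints as `T` and with a regular vertical
diagram, and at each height it is closer than `ε` to `T`. -/
def IsRegularApprox (T T' : Tangle) (ε : ℝ) : Prop :=
  T'.IsZMonotone ∧ T'.IsVerticallyRegular ∧
    T'.lam 0 = T.lam 0 ∧ T'.lam 1 = T.lam 1 ∧ T'.rho 0 = T.rho 0 ∧ T'.rho 1 = T.rho 1 ∧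
    ∀ z ∈ Icc (0 : ℝ) 3, dist (atHeight T'.lam z) (atHeight T.lam z) < ε ∧
      dist (atHeight T'.rho z) (atHeight T.rho z) < ε

/-- The linking index of the `z`-monotone tangle `T` is `k`: it is the linking index of its braid
diagram, where a vertical projection that is not regular is made regular, as usual, by a
sufficiently small perturbation of the tangle. If the vertical diagram of `T` is already regular,
then `T` is an approximation of itself, so `k` is the linking index of this very diagram. -/
def HasLinkingIndex (T : Tangle) (k : ℚ) : Prop :=
  (∀ ε > 0, ∃ T', T.IsRegularApprox T' ε) ∧
    ∃ ε > 0, ∀ T', T.IsRegularApprox T' ε → T'.diagramIndex = k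

end Tangle

end

open Set unitInterval

noncomputable section

/-! A `z`-monotone tangle over `U` amounts to running through `L` and `R` simultaneously without
collision, that is, to a path with strictly increasing coordinates `(t, s)` in the unit square from
corner to corner which avoids the finite set `P` of zeros of `F (t, s) = R s - L t` (for negative
rank, `R` is first reversed). At both ends the gap `F` points to the right. The braid diagram has a
crossing exactly when the gap has no `x`-component, and each signed crossing is a signed half turn
of the gap. Hence the linking index is the number of full turns of `F` along the path, and it
suffices to find a path with winding number `± m / 2`.

Transversality makes the zeros of `F` simple, so `F` is an exponential times a product of one
real-linear factor per zero (`exists_log_mul_prod`, `exists_tendsto_div_linFactor`). Consequently,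
pushing a path across a zero changes its winding number by `± 1`. The path along the left and top
sides of the square has winding number zero, because the endpoints of the arcs lie on the boundary
circle and the gap never points straight to the left there. A path with the set `S` of zeros on its
upper left side therefore has as its winding number the sum of the signs over `S`
(`IsSeparatingPath.exists_log`). Every subset of `P` closed under going up and left arises from a
strictly increasing path (`exists_strictMono_isSeparatingPath`).

The rest is combinatorics (`exists_upper_subset_abs_sum_eq`). The `m` crossings of the rank
condition increase in both coordinates, so they form an antichain for the up-left order. Let `A` be
the set of zeros above this antichain. Adding to `A` the positive or the negative members of the
antichain gives two upper sets whose sums differ by `m`, so one of the sums has absolute value at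
least `m / 2`. Removing minimal points one at a time changes the sum by `± 1` and reaches `± m / 2`.

Since the vertical projection need not be regular, the index is read off from perturbations. Close
gaps with the same end values have the same winding (`hasLinkingIndex_of_log`), and regular
perturbations are built from Bernstein polynomials and a generic parameter
(`exists_isRegularApprox_ofGraphs`). -/

/-! ### Logarithms of planar maps with simple zeros -/

/-- The unit square. -/
abbrev unitSquare : Set (ℝ × ℝ) := Icc (0 : ℝ) 1 ×ˢ Icc (0 : ℝ) 1

/-- Clamping both coordinates extends `G` to a nonvanishing continuous function on the whole plane,
which is open and simply connected, so it lifts through `exp`. -/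
theorem exists_log_on_unitSquare {G : ℝ × ℝ → ℂ} (hG : ContinuousOn G unitSquare)
    (h0 : ∀ q ∈ unitSquare, G q ≠ 0) :
    ∃ g : ℝ × ℝ → ℂ, ContinuousOn g unitSquare ∧ ∀ q ∈ unitSquare, G q = Complex.exp (g q) := by
  let c : ℝ × ℝ → ℝ × ℝ := fun q => (projIcc 0 1 zero_le_one q.1, projIcc 0 1 zero_le_one q.2)
  have hc : Continuous c := by
    refine Continuous.prodMk ?_ ?_
    · exact continuous_subtype_val.comp (continuous_projIcc.comp continuous_fst)
    · exact continuous_subtype_val.comp (continuous_projIcc.comp continuous_snd)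
  have hcm : ∀ q, c q ∈ unitSquare := fun q => ⟨Subtype.prop _, Subtype.prop _⟩
  have hcid : ∀ q ∈ unitSquare, c q = q := fun q hq => by
    ext
    · simp [c, projIcc_of_mem zero_le_one hq.1]
    · simp [c, projIcc_of_mem zero_le_one hq.2]
  obtain ⟨g, hg, hgG⟩ := Complex.exists_continuousOn_eqOn_exp_comp (X := ℝ × ℝ) (U := univ)
    (g := G ∘ c) (by
      have := (convex_univ (𝕜 := ℝ) (E := ℝ × ℝ)).contractibleSpace univ_nonempty
      exact SimplyConnectedSpace.ofContractible _) isOpen_univ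
    (hG.comp hc.continuousOn fun q _ => hcm q)
    (by rintro ⟨q, -, hq⟩; exact h0 _ (hcm q) hq)
  refine ⟨g, hg.mono (subset_univ _), fun q hq => ?_⟩
  have := hgG (mem_univ q)
  simp only [Function.comp_apply, hcid q hq] at this
  exact this.symm

/-- A continuous map on the square whose zeros `p` are asymptotic to given factors `a p` is the
product of these factors and of the exponential of a continuous function. -/
theorem exists_log_mul_prod (a : ℝ × ℝ → ℝ × ℝ → ℂ) (ha : ∀ p, Continuous (a p))
    (P : Finset (ℝ × ℝ)) (ha0 : ∀ p ∈ P, ∀ q, a p q = 0 ↔ q = p) (F : ℝ × ℝ → ℂ)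
    (hF : ContinuousOn F unitSquare) (hF0 : ∀ q ∈ unitSquare, F q = 0 → q ∈ P)
    (hlim : ∀ p ∈ P, ∃ c : ℂ, c ≠ 0 ∧
      Filter.Tendsto (fun q => F q / a p q) (nhdsWithin p (unitSquare \ {p})) (nhds c)) :
    ∃ g : ℝ × ℝ → ℂ, ContinuousOn g unitSquare ∧
      ∀ q ∈ unitSquare, q ∉ P → F q = Complex.exp (g q) * ∏ p ∈ P, a p q := by
  classical
  induction P using Finset.induction_on generalizing F with
  | empty =>
    obtain ⟨g, hg, h⟩ := exists_log_on_unitSquare hF fun q hq h => by simpa using hF0 q hq h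
    exact ⟨g, hg, fun q hq _ => by simpa using h q hq⟩
  | insert p P hp ih =>
    obtain ⟨c, hc0, hc⟩ := hlim p (Finset.mem_insert_self _ _)
    have hap := ha0 p (Finset.mem_insert_self _ _)
    -- Dividing out the factor at `p` and filling in the nonzero limit removes this zero and creates
    -- no other.
    let F₁ : ℝ × ℝ → ℂ := Function.update (fun q => F q / a p q) p c
    have hF₁ : ∀ q, q ≠ p → F₁ q = F q / a p q := fun q hq => Function.update_of_ne hq _ _
    have c₁ : ContinuousOn F₁ unitSquare := by
      rw [continuousOn_update_iff]
      refine ⟨?_, fun _ => hc⟩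
      refine (hF.mono sdiff_subset).div (ha p).continuousOn fun q hq h0 => hq.2 ((hap q).1 h0)
    have c₂ : ∀ q ∈ unitSquare, F₁ q = 0 → q ∈ P := by
      intro q hq hq0
      by_cases hqp : q = p
      · subst hqp
        exact absurd hq0 (by simpa [F₁] using hc0)
      · rw [hF₁ q hqp, div_eq_zero_iff, or_iff_left (fun h0 => hqp ((hap q).1 h0))] at hq0
        exact (Finset.mem_insert.1 (hF0 q hq hq0)).resolve_left hqp
    have c₃ : ∀ p ∈ P, ∃ c : ℂ, c ≠ 0 ∧
        Filter.Tendsto (fun q => F₁ q / a p q) (nhdsWithin p (unitSquare \ {p})) (nhds c) := by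
      intro p' hp'
      have hpp' : p' ≠ p := fun h => hp (h ▸ hp')
      obtain ⟨c', hc'0, hc'⟩ := hlim p' (Finset.mem_insert_of_mem hp')
      have hne : a p p' ≠ 0 := fun h0 => hpp' ((hap p').1 h0)
      refine ⟨c' / a p p', div_ne_zero hc'0 hne, ?_⟩
      refine (hc'.div ((ha p).continuousAt.tendsto.mono_left nhdsWithin_le_nhds) hne).congr' ?_
      filter_upwards [nhdsWithin_le_nhds (isOpen_ne.mem_nhds hpp')] with q hq
      simp only [Pi.div_apply]
      rw [hF₁ q hq, div_right_comm]
    obtain ⟨g, hg, h⟩ := ih (fun p' hp' => ha0 p' (Finset.mem_insert_of_mem hp')) F₁ c₁ c₂ c₃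
    refine ⟨g, hg, fun q hq hqP => ?_⟩
    rw [Finset.mem_insert, not_or] at hqP
    have := h q hq hqP.2
    rw [hF₁ q hqP.1, div_eq_iff (fun h0 => hqP.1 ((hap q).1 h0))] at this
    rw [Finset.prod_insert hp, this]
    ring

/-! ### Linear factors at transverse crossings -/

/-- The normalised linear form which takes the values `1` at `(-1, 1)` and `κ` at `(1, 1)`,
translated to the point `p`. -/
def linFactor (κ : ℂ) (p q : ℝ × ℝ) : ℂ :=
  (((q.2 - p.2) - (q.1 - p.1)) / 2 : ℝ) + (((q.1 - p.1) + (q.2 - p.2)) / 2 : ℝ) * κ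

theorem continuous_linFactor (κ : ℂ) (p : ℝ × ℝ) : Continuous (linFactor κ p) := by
  unfold linFactor
  fun_prop

theorem linFactor_re (κ : ℂ) (p q : ℝ × ℝ) : (linFactor κ p q).re =
    ((q.2 - p.2) - (q.1 - p.1)) / 2 + ((q.1 - p.1) + (q.2 - p.2)) / 2 * κ.re := by
  simp only [linFactor, Complex.add_re, Complex.ofReal_re, Complex.re_ofReal_mul]

theorem linFactor_im (κ : ℂ) (p q : ℝ × ℝ) : (linFactor κ p q).im =
    ((q.1 - p.1) + (q.2 - p.2)) / 2 * κ.im := by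
  simp only [linFactor, Complex.add_im, Complex.ofReal_im, Complex.im_ofReal_mul, zero_add]

theorem linFactor_eq_zero_iff {κ : ℂ} (hκ : κ.im ≠ 0) (p q : ℝ × ℝ) :
    linFactor κ p q = 0 ↔ q = p := by
  constructor
  · intro h
    have h1 := linFactor_im κ p q
    have h2 := linFactor_re κ p q
    rw [h] at h1 h2
    have h3 : (q.1 - p.1) + (q.2 - p.2) = 0 := by
      have := (mul_eq_zero.1 h1.symm).resolve_right hκ
      linarith
    rw [h3] at h2
    simp only [Complex.zero_re, zero_div, zero_mul, add_zero] at h2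
    ext <;> linarith
  · rintro rfl
    simp [linFactor]

/-- At a transverse intersection of two curves, their difference is asymptotic to a linear
factor. -/
theorem exists_tendsto_div_linFactor {L R : ℝ → ℂ} {p : ℝ × ℝ} {u v : ℂ}
    (hL : HasDerivAt L u p.1) (hR : HasDerivAt R v p.2) (h0 : R p.2 = L p.1)
    (huv : u.re * v.im - u.im * v.re ≠ 0) :
    ∃ κ : ℂ, κ.im ≠ 0 ∧ ∃ c : ℂ, c ≠ 0 ∧
      Filter.Tendsto (fun q : ℝ × ℝ => (R q.2 - L q.1) / linFactor κ p q)
        (nhdsWithin p {p}ᶜ) (nhds c) := by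
  have hne : v + u ≠ 0 := by
    intro h
    have : v = -u := by linear_combination h
    subst this
    apply huv
    simp only [Complex.neg_re, Complex.neg_im]
    ring
  have hκ : ((v - u) / (v + u)).im ≠ 0 := by
    rw [Complex.div_im, ← sub_div]
    refine div_ne_zero ?_ (Complex.normSq_pos.2 hne).ne'
    intro h
    apply huv
    simp only [Complex.sub_im, Complex.sub_re, Complex.add_re, Complex.add_im] at h
    linarith
  refine ⟨_, hκ, v + u, hne, ?_⟩
  -- The derivative of `R q.2 - L q.1` takes the values `v + u` at `(-1, 1)` and `v - u` at `(1,
  -- 1)`, so it is `v + u` times the factor for their quotient `κ`.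
  set κ := (v - u) / (v + u) with hκdef
  have hA : ∀ q : ℝ × ℝ, (v + u) * linFactor κ p q =
      (q.2 - p.2 : ℝ) * v - (q.1 - p.1 : ℝ) * u := by
    intro q
    have : (v + u) * κ = v - u := mul_div_cancel₀ _ hne
    simp only [linFactor]
    push_cast
    linear_combination (((q.1 - p.1 : ℂ) + (q.2 - p.2)) / 2) * this
  have hF := (hR.hasFDerivAt.comp p (hasFDerivAt_snd (𝕜 := ℝ))).sub
      (hL.hasFDerivAt.comp p (hasFDerivAt_fst (𝕜 := ℝ)))
  have ho := hF.isLittleO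
  -- Since `u` and `v` are independent, the derivative is invertible; Cramer's rule bounds `q - p`
  -- by its value, which turns the `o(q - p)` error into a relative error.
  have hO : (fun q : ℝ × ℝ => q - p) =O[nhds p] fun q => (v + u) * linFactor κ p q := by
    have hD : ∀ q : ℝ × ℝ, ((v + u) * linFactor κ p q).re * u.im
        - ((v + u) * linFactor κ p q).im * u.re
        = - (u.re * v.im - u.im * v.re) * (q.2 - p.2) ∧
        ((v + u) * linFactor κ p q).re * v.im - ((v + u) * linFactor κ p q).im * v.re
        = - (u.re * v.im - u.im * v.re) * (q.1 - p.1) := by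
      intro q
      rw [hA]
      simp only [Complex.sub_re, Complex.sub_im, Complex.re_ofReal_mul, Complex.im_ofReal_mul]
      constructor <;> ring
    have hbound : ∀ w z : ℂ, ‖w.re * z.im - w.im * z.re‖ ≤ 2 * ‖z‖ * ‖w‖ := by
      intro w z
      have h1 := Complex.abs_re_le_norm w
      have h2 := Complex.abs_im_le_norm w
      have h3 := Complex.abs_re_le_norm z
      have h4 := Complex.abs_im_le_norm z
      calc ‖w.re * z.im - w.im * z.re‖ ≤ |w.re| * |z.im| + |w.im| * |z.re| := by
            rw [← abs_mul, ← abs_mul]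
            exact abs_sub _ _
        _ ≤ ‖w‖ * ‖z‖ + ‖w‖ * ‖z‖ := by gcongr
        _ = _ := by ring
    set D := u.re * v.im - u.im * v.re with hDdef
    have hDp : 0 < |D| := abs_pos.2 huv
    have key : ∀ (w z : ℂ) (x : ℝ), w.re * z.im - w.im * z.re = -D * x →
        ‖x‖ ≤ 2 * ‖z‖ / |D| * ‖w‖ := by
      intro w z x h
      have := hbound w z
      rw [h, norm_mul, norm_neg, Real.norm_eq_abs D] at this
      rw [div_mul_eq_mul_div, le_div_iff₀ hDp]
      linarith
    refine Asymptotics.IsBigO.of_bound (2 * ‖u‖ / |D| + 2 * ‖v‖ / |D|)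
      (Filter.Eventually.of_forall fun q => ?_)
    have k1 := key _ _ _ (hD q).1
    have k2 := key _ _ _ (hD q).2
    have n1 : 0 ≤ 2 * ‖u‖ / |D| * ‖(v + u) * linFactor κ p q‖ := by positivity
    have n2 : 0 ≤ 2 * ‖v‖ / |D| * ‖(v + u) * linFactor κ p q‖ := by positivity
    rw [Prod.norm_def, add_mul]
    refine max_le ?_ ?_
    · exact k2.trans (by linarith)
    · exact k1.trans (by linarith)
  have hequiv := ho.trans_isBigO hO
  have h1 := hequiv.tendsto_div_nhds_zero.mono_left (nhdsWithin_le_nhds (s := {p}ᶜ))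
  have h2 := (h1.add_const 1).const_mul (v + u)
  rw [zero_add, mul_one] at h2
  refine h2.congr' ?_
  filter_upwards [self_mem_nhdsWithin] with q hq
  have hq0 : linFactor κ p q ≠ 0 := fun h => hq ((linFactor_eq_zero_iff hκ p q).1 h)
  field_simp
  rw [hA]
  simp [h0]

/-! ### Counting half turns -/

/-- The number of half turns of an angle, rounded to the nearest integer. -/
def halfTurns (x : ℝ) : ℤ := ⌊x / Real.pi + 1 / 2⌋

theorem halfTurns_eq_of_abs_lt {x : ℝ} {n : ℤ} (h : |x - n * Real.pi| < Real.pi / 2) :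
    halfTurns x = n := by
  have hpi := Real.pi_pos
  rw [abs_lt] at h
  rw [halfTurns, Int.floor_eq_iff]
  have hx : x / Real.pi * Real.pi = x := div_mul_cancel₀ _ hpi.ne'
  constructor
  · by_contra! hc
    nlinarith
  · by_contra! hc
    nlinarith

theorem halfTurns_add_two_pi_mul (x : ℝ) (n : ℤ) :
    halfTurns (x + 2 * Real.pi * n) = halfTurns x + 2 * n := by
  have : (x + 2 * Real.pi * n) / Real.pi + 1 / 2 = x / Real.pi + 1 / 2 + ((2 * n : ℤ) : ℝ) := by
    have := Real.pi_ne_zero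
    push_cast
    field_simp
    ring
  rw [halfTurns, this, Int.floor_add_intCast, halfTurns]

theorem halfTurns_eq_zero_of_abs_lt {x : ℝ} (h : |x| < Real.pi / 2) : halfTurns x = 0 :=
  halfTurns_eq_of_abs_lt (by simpa using h)

/-- The rounded number of half turns can change only at odd multiples of `π / 2`, where the cosine
vanishes; the intermediate value theorem supplies such a point. -/
theorem halfTurns_le_of_cos_ne_zero {φ : ℝ → ℝ} {a b : ℝ} (hφ : ContinuousOn φ (uIcc a b))
    (h : ∀ z ∈ uIcc a b, Real.cos (φ z) ≠ 0) : halfTurns (φ b) ≤ halfTurns (φ a) := by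
  by_contra! hlt
  have hpi := Real.pi_pos
  set n := halfTurns (φ b) with hn
  have h1 : (n : ℝ) ≤ φ b / Real.pi + 1 / 2 := Int.floor_le _
  have h2 : φ a / Real.pi + 1 / 2 < n := Int.floor_lt.1 hlt
  rw [← sub_le_iff_le_add, le_div_iff₀ hpi] at h1
  rw [← lt_sub_iff_add_lt, div_lt_iff₀ hpi] at h2
  obtain ⟨c, hc, hcv⟩ := intermediate_value_uIcc hφ (mem_uIcc.2 (Or.inl ⟨h2.le, h1⟩))
  apply h c hc
  rw [hcv, Real.cos_eq_zero_iff]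
  exact ⟨n - 1, by push_cast; ring⟩

/-- A continuous angle whose cosine does not vanish makes no half turn. -/
theorem halfTurns_eq_of_cos_ne_zero {φ : ℝ → ℝ} {a b : ℝ} (hφ : ContinuousOn φ (uIcc a b))
    (h : ∀ z ∈ uIcc a b, Real.cos (φ z) ≠ 0) : halfTurns (φ a) = halfTurns (φ b) :=
  le_antisymm (halfTurns_le_of_cos_ne_zero (by rwa [uIcc_comm]) (by rwa [uIcc_comm]))
    (halfTurns_le_of_cos_ne_zero hφ h)

/-- Two continuous logarithms of the same function have the same variation of the argument. -/
theorem im_sub_im_eq_of_exp_eq {h h' : ℝ → ℂ} {a b : ℝ} (hab : a ≤ b)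
    (hc : ContinuousOn h (Icc a b)) (hc' : ContinuousOn h' (Icc a b))
    (he : ∀ z ∈ Icc a b, Complex.exp (h z) = Complex.exp (h' z)) :
    (h b).im - (h a).im = (h' b).im - (h' a).im := by
  have key : ∀ z ∈ Icc a b, ∃ n : ℤ, (h z).im - (h' z).im = 2 * Real.pi * n := by
    intro z hz
    obtain ⟨n, hn⟩ := Complex.exp_eq_exp_iff_exists_int.1 (he z hz)
    refine ⟨n, ?_⟩
    rw [hn]
    simp
    ring
  -- The difference of the two arguments is continuous with values in `2πℤ`; its cosine is always
  -- `1`, so its number of half turns is constant.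
  have hturn := halfTurns_eq_of_cos_ne_zero (φ := fun z => (h z).im - (h' z).im) (a := a) (b := b)
    (by
      rw [uIcc_of_le hab]
      exact (Complex.continuous_im.comp_continuousOn hc).sub
        (Complex.continuous_im.comp_continuousOn hc'))
    (by
      rw [uIcc_of_le hab]
      intro z hz
      obtain ⟨n, hn⟩ := key z hz
      simp only [hn]
      rw [show 2 * Real.pi * n = n * (2 * Real.pi) by ring, Real.cos_int_mul_two_pi]
      exact one_ne_zero)
  obtain ⟨n, hn⟩ := key a (left_mem_Icc.2 hab)
  obtain ⟨n', hn'⟩ := key b (right_mem_Icc.2 hab)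
  simp only [hn, hn'] at hturn
  have e : ∀ n : ℤ, halfTurns (2 * Real.pi * n) = 2 * n := by
    intro n
    have := halfTurns_add_two_pi_mul 0 n
    rw [zero_add] at this
    rw [this, halfTurns_eq_zero_of_abs_lt (by simpa using Real.pi_div_two_pos), zero_add]
  rw [e, e] at hturn
  have : n = n' := by omega
  subst this
  linarith

/-! ### Monotone paths in the square and the variation of the argument along them -/

/-- A path `u ↦ (t u, s u)` in the unit square, with `t + s = 2 u`, which has the points of `S`
on its upper left side and the other points of `P` on its lower right side. -/
structure IsSeparatingPath (P S : Finset (ℝ × ℝ)) (t s : ℝ → ℝ) : Prop where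
  continuousOn_fst : ContinuousOn t (Icc 0 1)
  continuousOn_snd : ContinuousOn s (Icc 0 1)
  mem : ∀ u ∈ Icc (0 : ℝ) 1, (t u, s u) ∈ unitSquare
  add_eq : ∀ u ∈ Icc (0 : ℝ) 1, t u + s u = 2 * u
  above : ∀ p ∈ S, ∀ u ∈ Icc (0 : ℝ) 1, 2 * u = p.1 + p.2 → s u - t u < p.2 - p.1
  below : ∀ p ∈ P, p ∉ S → ∀ u ∈ Icc (0 : ℝ) 1, 2 * u = p.1 + p.2 → p.2 - p.1 < s u - t u

namespace IsSeparatingPath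

variable {P S : Finset (ℝ × ℝ)} {t s : ℝ → ℝ}

theorem notMem (h : IsSeparatingPath P S t s) (u : ℝ) (hu : u ∈ Icc (0 : ℝ) 1) :
    (t u, s u) ∉ P := by
  intro hp
  have h1 := h.add_eq u hu
  by_cases hS : (t u, s u) ∈ S
  · exact lt_irrefl _ (h.above _ hS u hu h1.symm)
  · exact lt_irrefl _ (h.below _ hp hS u hu h1.symm)

theorem apply_zero (h : IsSeparatingPath P S t s) : (t 0, s 0) = ((0, 0) : ℝ × ℝ) := by
  have h0 : (0 : ℝ) ∈ Icc (0 : ℝ) 1 := by simp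
  have h1 := h.add_eq 0 h0
  have h2 := (h.mem 0 h0).1.1
  have h3 := (h.mem 0 h0).2.1
  ext <;> simp only at * <;> linarith

theorem apply_one (h : IsSeparatingPath P S t s) : (t 1, s 1) = ((1, 1) : ℝ × ℝ) := by
  have h0 : (1 : ℝ) ∈ Icc (0 : ℝ) 1 := by simp
  have h1 := h.add_eq 1 h0
  have h2 := (h.mem 1 h0).1.2
  have h3 := (h.mem 1 h0).2.2
  ext <;> simp only at * <;> linarith

end IsSeparatingPath

/-- The imaginary part vanishes only on the antidiagonal through `p`, and there the real part is
positive exactly on the upper left side. A path passing on that side thus admits the principal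
logarithm, and one passing on the other side admits that of the negated factor. -/
theorem linFactor_mem_slitPlane {κ : ℂ} (hκ : κ.im ≠ 0) {p q : ℝ × ℝ}
    (h : q.1 + q.2 = p.1 + p.2 → p.2 - p.1 < q.2 - q.1) :
    linFactor κ p q ∈ Complex.slitPlane := by
  rw [Complex.mem_slitPlane_iff, linFactor_re, linFactor_im]
  by_cases hq : q.1 + q.2 = p.1 + p.2
  · left
    rw [show (q.1 - p.1) + (q.2 - p.2) = 0 by linarith]
    linarith [h hq]
  · right
    refine mul_ne_zero ?_ hκ
    intro h0
    apply hq
    linarith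

theorem neg_linFactor_mem_slitPlane {κ : ℂ} (hκ : κ.im ≠ 0) {p q : ℝ × ℝ}
    (h : q.1 + q.2 = p.1 + p.2 → q.2 - q.1 < p.2 - p.1) :
    -linFactor κ p q ∈ Complex.slitPlane := by
  rw [Complex.mem_slitPlane_iff, Complex.neg_re, Complex.neg_im, linFactor_re, linFactor_im]
  by_cases hq : q.1 + q.2 = p.1 + p.2
  · left
    rw [show (q.1 - p.1) + (q.2 - p.2) = 0 by linarith]
    linarith [h hq]
  · right
    refine neg_ne_zero.2 (mul_ne_zero ?_ hκ)
    intro h0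
    apply hq
    linarith

/-- The change of the winding number when a monotone path is pushed to the other side of a zero
with linear factor `linFactor κ p`. -/
def crossingIndex (κ : ℂ) : ℤ := if 0 < κ.im then -1 else 1

/-- The two corners lie on opposite sides of the antidiagonal through `p`, so negating the factor
shifts the two arguments by `π` in opposite directions. -/
theorem arg_neg_linFactor_sub {κ : ℂ} (hκ : κ.im ≠ 0) {p : ℝ × ℝ} (h0 : 0 < p.1 + p.2)
    (h1 : p.1 + p.2 < 2) :
    (-linFactor κ p (1, 1)).arg - (-linFactor κ p (0, 0)).arg =
      (linFactor κ p (1, 1)).arg - (linFactor κ p (0, 0)).arg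
        + 2 * Real.pi * crossingIndex κ := by
  have i1 := linFactor_im κ p (1, 1)
  have i0 := linFactor_im κ p (0, 0)
  simp only at i0 i1
  rw [crossingIndex]
  split_ifs with hpos
  · rw [Complex.arg_neg_eq_arg_sub_pi_of_im_pos, Complex.arg_neg_eq_arg_add_pi_of_im_neg]
    · push_cast; ring
    · rw [i0]; exact mul_neg_of_neg_of_pos (by linarith) hpos
    · rw [i1]; exact mul_pos (by linarith) hpos
  · have hneg : κ.im < 0 := lt_of_le_of_ne (not_lt.1 hpos) hκ
    rw [Complex.arg_neg_eq_arg_add_pi_of_im_neg, Complex.arg_neg_eq_arg_sub_pi_of_im_pos]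
    · push_cast; ring
    · rw [i0]; exact mul_pos_of_neg_of_neg (by linarith) hneg
    · rw [i1]; exact mul_neg_of_pos_of_neg (by linarith) hneg

/-- The variation of the argument along a separating path. -/
theorem IsSeparatingPath.exists_log {P S : Finset (ℝ × ℝ)} {t s : ℝ → ℝ}
    (hpath : IsSeparatingPath P S t s) (hS : S ⊆ P) {F g : ℝ × ℝ → ℂ} {κ : ℝ × ℝ → ℂ}
    (hκ : ∀ p ∈ P, (κ p).im ≠ 0) (hP : ∀ p ∈ P, 0 < p.1 + p.2 ∧ p.1 + p.2 < 2)
    (hg : ContinuousOn g unitSquare)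
    (hF : ∀ q ∈ unitSquare, q ∉ P → F q = Complex.exp (g q) * ∏ p ∈ P, linFactor (κ p) p q) :
    ∃ h : ℝ → ℂ, ContinuousOn h (Icc 0 1) ∧
      (∀ u ∈ Icc (0 : ℝ) 1, F (t u, s u) = Complex.exp (h u)) ∧
      (h 1).im - (h 0).im = (g (1, 1)).im - (g (0, 0)).im +
        ∑ p ∈ P, ((linFactor (κ p) p (1, 1)).arg - (linFactor (κ p) p (0, 0)).arg) +
        2 * Real.pi * (∑ p ∈ S, crossingIndex (κ p) : ℤ) := by
  classical
  -- A branch of the logarithm of each factor which is continuous along the path, chosen by the side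
  -- on which the path passes `p`.
  let l : ℝ × ℝ → ℝ × ℝ → ℂ := fun p q =>
    if p ∈ S then Complex.log (-linFactor (κ p) p q) + Real.pi * Complex.I
      else Complex.log (linFactor (κ p) p q)
  have hcont : ContinuousOn (fun u => (t u, s u)) (Icc 0 1) :=
    hpath.continuousOn_fst.prodMk hpath.continuousOn_snd
  have hmemS : ∀ p ∈ S, ∀ u ∈ Icc (0 : ℝ) 1,
      -linFactor (κ p) p (t u, s u) ∈ Complex.slitPlane := fun p hp u hu =>
    neg_linFactor_mem_slitPlane (hκ p (hS hp)) fun he =>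
      hpath.above p hp u hu (by rw [← he, hpath.add_eq u hu])
  have hmem : ∀ p ∈ P, p ∉ S → ∀ u ∈ Icc (0 : ℝ) 1,
      linFactor (κ p) p (t u, s u) ∈ Complex.slitPlane := fun p hp hpS u hu =>
    linFactor_mem_slitPlane (hκ p hp) fun he =>
      hpath.below p hp hpS u hu (by rw [← he, hpath.add_eq u hu])
  refine ⟨fun u => g (t u, s u) + ∑ p ∈ P, l p (t u, s u), ?_, ?_, ?_⟩
  · refine (hg.comp hcont hpath.mem).add (continuousOn_finsetSum _ fun p hp => ?_)
    have hlc := (continuous_linFactor (κ p) p).comp_continuousOn hcont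
    by_cases hpS : p ∈ S
    · simp only [l, if_pos hpS]
      exact (hlc.neg.clog (hmemS p hpS)).add continuousOn_const
    · simp only [l, if_neg hpS]
      exact hlc.clog (hmem p hp hpS)
  · intro u hu
    rw [hF _ (hpath.mem u hu) (hpath.notMem u hu), Complex.exp_add, Complex.exp_sum]
    congr 1
    refine Finset.prod_congr rfl fun p hp => ?_
    by_cases hpS : p ∈ S
    · simp only [l, if_pos hpS]
      rw [Complex.exp_add, Complex.exp_log (Complex.slitPlane_ne_zero (hmemS p hpS u hu)),
        Complex.exp_pi_mul_I]
      ring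
    · simp only [l, if_neg hpS]
      rw [Complex.exp_log (Complex.slitPlane_ne_zero (hmem p hp hpS u hu))]
  · simp only [hpath.apply_zero, hpath.apply_one, Complex.add_im, Complex.im_sum]
    have hl : ∀ p ∈ P, (l p (1, 1)).im - (l p (0, 0)).im =
        ((linFactor (κ p) p (1, 1)).arg - (linFactor (κ p) p (0, 0)).arg) +
          if p ∈ S then 2 * Real.pi * crossingIndex (κ p) else 0 := by
      intro p hp
      by_cases hpS : p ∈ S
      · simp only [l, if_pos hpS, Complex.add_im, Complex.log_im]
        rw [← arg_neg_linFactor_sub (hκ p hp) (hP p hp).1 (hP p hp).2]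
        ring
      · simp only [l, if_neg hpS, Complex.log_im, add_zero]
    have hsum := Finset.sum_congr rfl hl
    rw [Finset.sum_sub_distrib, Finset.sum_add_distrib, Finset.sum_ite_mem,
      Finset.inter_eq_right.2 hS, ← Finset.mul_sum] at hsum
    push_cast
    linarith

/-- The path along the left side and the top side of the square. -/
theorem isSeparatingPath_boundary {P : Finset (ℝ × ℝ)}
    (hP : ∀ p ∈ P, 0 < p.1 ∧ p.1 < 1 ∧ 0 < p.2 ∧ p.2 < 1) :
    IsSeparatingPath P ∅ (fun u => max 0 (2 * u - 1)) (fun u => min 1 (2 * u)) where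
  continuousOn_fst := by fun_prop
  continuousOn_snd := by fun_prop
  mem u hu := by
    obtain ⟨h0, h1⟩ := hu
    refine ⟨⟨le_max_left _ _, max_le (by norm_num) ?_⟩, le_min ?_ ?_, min_le_left _ _⟩
    all_goals linarith
  add_eq u hu := by
    rcases le_total (2 * u) 1 with h | h
    · rw [max_eq_left (by linarith), min_eq_right h]; ring
    · rw [max_eq_right (by linarith), min_eq_left h]; ring
  above p hp := by simp at hp
  below p hp _ u hu h := by
    obtain ⟨h1, h2, h3, h4⟩ := hP p hp
    rcases le_total (2 * u) 1 with h | h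
    · rw [max_eq_left (by linarith), min_eq_right h]; linarith
    · rw [max_eq_right (by linarith), min_eq_left h]; linarith

/-! ### Upper sets of signed points -/

/-- Deleting a minimal element keeps an upper set upper and lowers the sum by at most `1`, so the
descent towards the empty set cannot jump over `k`. -/
theorem exists_upper_subset_sum_eq {α : Type*} [PartialOrder α] (P : Finset α) {ε : α → ℤ}
    (hε : ∀ p, ε p ≤ 1) (S : Finset α) (hS : S ⊆ P) (hup : ∀ p ∈ S, ∀ q ∈ P, p ≤ q → q ∈ S)
    (k : ℕ) (hk : (k : ℤ) ≤ ∑ p ∈ S, ε p) :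
    ∃ S' ⊆ P, (∀ p ∈ S', ∀ q ∈ P, p ≤ q → q ∈ S') ∧ ∑ p ∈ S', ε p = k := by
  classical
  induction S using Finset.strongInduction with
  | H S ih =>
    rcases hk.eq_or_lt with h | h
    · exact ⟨S, hS, hup, h.symm⟩
    have hne : S.Nonempty := by
      rw [Finset.nonempty_iff_ne_empty]
      rintro rfl
      simp only [Finset.sum_empty] at h
      omega
    obtain ⟨x, hx⟩ := S.exists_minimal hne
    refine ih (S.erase x) (Finset.erase_ssubset hx.1) ((Finset.erase_subset _ _).trans hS) ?_ ?_
    · intro p hp q hq hpq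
      rw [Finset.mem_erase] at hp ⊢
      refine ⟨?_, hup p hp.2 q hq hpq⟩
      rintro rfl
      exact hp.1 (le_antisymm hpq (hx.2 hp.2 hpq))
    · have := Finset.add_sum_erase S ε hx.1
      have := hε x
      omega

/-- If a finite ordered set of signed points has an antichain of `2 k` points, then it has an upper
set whose sum of signs is `k` or `-k`. -/
theorem exists_upper_subset_abs_sum_eq {α : Type*} [PartialOrder α] (P C : Finset α) {ε : α → ℤ}
    (hε : ∀ p, ε p = 1 ∨ ε p = -1) (hCP : C ⊆ P) (hC : IsAntichain (· ≤ ·) (C : Set α))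
    (k : ℕ) (hk : C.card = 2 * k) :
    ∃ S ⊆ P, (∀ p ∈ S, ∀ q ∈ P, p ≤ q → q ∈ S) ∧ |∑ p ∈ S, ε p| = k := by
  classical
  let A : Finset α := P.filter fun q => q ∉ C ∧ ∃ p ∈ C, p ≤ q
  have hA : ∀ D ⊆ C, (∀ p ∈ A ∪ D, ∀ q ∈ P, p ≤ q → q ∈ A ∪ D) := by
    intro D hD p hp q hq hpq
    have hle : ∃ c ∈ C, c ≤ p ∧ (p ∈ C → p ∈ D) := by
      rcases Finset.mem_union.1 hp with hp | hp
      · obtain ⟨-, hpC, c, hc, hcp⟩ := Finset.mem_filter.1 hp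
        exact ⟨c, hc, hcp, fun h => absurd h hpC⟩
      · exact ⟨p, hD hp, le_rfl, fun _ => hp⟩
    obtain ⟨c, hc, hcp, hpD⟩ := hle
    by_cases hqC : q ∈ C
    · have hcq : c = q := hC.eq hc hqC (hcp.trans hpq)
      have hpq' : p = q := le_antisymm hpq (hcq ▸ hcp)
      exact Finset.mem_union_right _ (hpq' ▸ hpD (hpq' ▸ hqC))
    · exact Finset.mem_union_left _ (Finset.mem_filter.2 ⟨hq, hqC, c, hc, hcp.trans hpq⟩)
  have hdisj : ∀ D ⊆ C, Disjoint A D := fun D hD =>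
    Finset.disjoint_left.2 fun x hx hxD => (Finset.mem_filter.1 hx).2.1 (hD hxD)
  have hsub : ∀ D ⊆ C, A ∪ D ⊆ P := fun D hD =>
    Finset.union_subset (Finset.filter_subset _ _) (hD.trans hCP)
  let Cp := C.filter fun p => ε p = 1
  let Cm := C.filter fun p => ¬ ε p = 1
  have hp : ∑ p ∈ Cp, ε p = Cp.card := by
    rw [Finset.sum_congr rfl fun p hp => (Finset.mem_filter.1 hp).2]
    simp [Cp]
  have hm : ∑ p ∈ Cm, ε p = -Cm.card := by
    rw [Finset.sum_congr rfl fun p hp => (hε p).resolve_left (Finset.mem_filter.1 hp).2]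
    simp [Cm]
  have hcard : Cp.card + Cm.card = 2 * k := by
    rw [← hk]
    exact Finset.card_filter_add_card_filter_not _
  have hpC : Cp ⊆ C := Finset.filter_subset _ _
  have hmC : Cm ⊆ C := Finset.filter_subset _ _
  have sp := Finset.sum_union (f := ε) (hdisj Cp hpC)
  have sm := Finset.sum_union (f := ε) (hdisj Cm hmC)
  -- The sums over `A ∪ Cp` and `A ∪ Cm` differ by `2 * k`: if the first is below `k`, the second is
  -- below `-k`, and the signs are reversed.
  rcases le_or_gt (k : ℤ) (∑ p ∈ A ∪ Cp, ε p) with h | h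
  · obtain ⟨S, hS, hup, hsum⟩ := exists_upper_subset_sum_eq P
      (fun p => by rcases hε p with h | h <;> omega) _ (hsub Cp hpC) (hA Cp hpC) k h
    exact ⟨S, hS, hup, by rw [hsum]; simp⟩
  · obtain ⟨S, hS, hup, hsum⟩ := exists_upper_subset_sum_eq P (ε := fun p => -ε p)
      (fun p => by rcases hε p with h | h <;> omega) _ (hsub Cm hmC) (hA Cm hmC) k (by
        rw [Finset.sum_neg_distrib]; omega)
    rw [Finset.sum_neg_distrib] at hsum
    exact ⟨S, hS, hup, by rw [← abs_neg, hsum]; simp⟩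

/-! ### Existence of monotone separating paths -/

theorem exists_min_lipschitz {α : Type*} (S : Finset α) (f : α → ℝ → ℝ) (f₀ : ℝ → ℝ) (c : ℝ)
    (hf : ∀ p ∈ S, ∀ x y, |f p x - f p y| ≤ c * |x - y|) (hf₀ : ∀ x y, |f₀ x - f₀ y| ≤ c * |x - y|) :
    ∃ d : ℝ → ℝ, (∀ x y, |d x - d y| ≤ c * |x - y|) ∧ (∀ x, d x ≤ f₀ x) ∧
      (∀ p ∈ S, ∀ x, d x ≤ f p x) ∧ ∀ x, d x = f₀ x ∨ ∃ p ∈ S, d x = f p x := by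
  classical
  induction S using Finset.induction_on with
  | empty => exact ⟨f₀, hf₀, fun _ => le_rfl, by simp, fun x => Or.inl rfl⟩
  | insert a S ha ih =>
    obtain ⟨d, hd, hle₀, hle, heq⟩ := ih fun p hp => hf p (Finset.mem_insert_of_mem hp)
    refine ⟨fun x => min (f a x) (d x), fun x y => ?_,
      fun x => (min_le_right _ _).trans (hle₀ x), ?_, fun x => ?_⟩
    · exact (abs_min_sub_min_le_max _ _ _ _).trans
        (max_le (hf a (Finset.mem_insert_self _ _) x y) (hd x y))
    · intro p hp x
      rcases Finset.mem_insert.1 hp with rfl | hp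
      · exact min_le_left _ _
      · exact (min_le_right _ _).trans (hle p hp x)
    · rcases min_choice (f a x) (d x) with h | h
      · exact Or.inr ⟨a, Finset.mem_insert_self _ _, h⟩
      · simp only [h]
        rcases heq x with h' | ⟨p, hp, h'⟩
        · exact Or.inl h'
        · exact Or.inr ⟨p, Finset.mem_insert_of_mem hp, h'⟩

/-- If `S` is closed in `P` under going up and left, then it is separated from its complement in `P`
by a path with strictly increasing coordinates. -/
theorem exists_strictMono_isSeparatingPath {P S : Finset (ℝ × ℝ)} (hS : S ⊆ P)
    (hP : ∀ p ∈ P, 0 < p.1 ∧ p.1 < 1 ∧ 0 < p.2 ∧ p.2 < 1)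
    (hup : ∀ p ∈ S, ∀ q ∈ P, q.1 ≤ p.1 → p.2 ≤ q.2 → q ∈ S) :
    ∃ t s : ℝ → ℝ, IsSeparatingPath P S t s ∧ StrictMono t ∧ StrictMono s := by
  -- All conditions on the slope `c` are strict inequalities at `c = 1`, hence hold for some `c <
  -- 1`. At `c = 1` the first one says that a point outside `S` is not up-left of a point of `S`.
  have ev : ∀ᶠ c : ℝ in nhdsWithin 1 (Iio 1), c ∈ Ioo (0 : ℝ) 1 ∧
      (∀ p ∈ S, ∀ q ∈ P, q ∉ S →
        q.2 - q.1 < p.2 - p.1 - (1 - c) + c * |(q.1 + q.2) - (p.1 + p.2)|) ∧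
      (∀ q ∈ P, q.2 - q.1 < c * min (q.1 + q.2) (2 - (q.1 + q.2))) ∧
      ∀ p ∈ S, 0 < p.2 - p.1 - (1 - c) + c * (p.1 + p.2) ∧
        0 < p.2 - p.1 - (1 - c) + c * (2 - (p.1 + p.2)) := by
    have lt_ev : ∀ (x : ℝ) (f : ℝ → ℝ), Continuous f → x < f 1 →
        ∀ᶠ c : ℝ in nhdsWithin 1 (Iio 1), x < f c := fun x f hf h =>
      nhdsWithin_le_nhds (hf.continuousAt.eventually (lt_mem_nhds h))
    refine Filter.Eventually.and (Ioo_mem_nhdsLT zero_lt_one) (Filter.Eventually.and ?_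
      (Filter.Eventually.and ?_ ?_))
    · rw [Filter.eventually_all_finset]
      intro p hp
      rw [Filter.eventually_all_finset]
      intro q hq
      by_cases hqS : q ∈ S
      · exact Filter.Eventually.of_forall fun c h => absurd hqS h
      refine (lt_ev _ (fun c => p.2 - p.1 - (1 - c) + c * |(q.1 + q.2) - (p.1 + p.2)|)
        (by fun_prop) ?_).mono fun c h _ => h
      by_contra! hc
      have h1 := le_abs_self ((q.1 + q.2) - (p.1 + p.2))
      have h2 := neg_abs_le ((q.1 + q.2) - (p.1 + p.2))
      exact hqS (hup p hp q hq (by linarith) (by linarith))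
    · rw [Filter.eventually_all_finset]
      intro q hq
      refine lt_ev _ (fun c => c * min (q.1 + q.2) (2 - (q.1 + q.2))) (by fun_prop) ?_
      obtain ⟨h1, h2, h3, h4⟩ := hP q hq
      rw [one_mul]
      exact lt_min (by linarith) (by linarith)
    · rw [Filter.eventually_all_finset]
      intro p hp
      obtain ⟨h1, h2, h3, h4⟩ := hP p (hS hp)
      refine (lt_ev _ (fun c => p.2 - p.1 - (1 - c) + c * (p.1 + p.2)) (by fun_prop) ?_).and
        (lt_ev _ (fun c => p.2 - p.1 - (1 - c) + c * (2 - (p.1 + p.2))) (by fun_prop) ?_)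
      · linarith
      · linarith
  obtain ⟨c, ⟨hc0, hc1⟩, hsep, hin, hpos⟩ := ev.exists
  -- `d` is the height `s - t` of the path as a function of `x = t + s`: a lower envelope of cones
  -- whose tips lie `1 - c` below the points of `S`, cut off by a tent vanishing at `0` and `2`. Its
  -- Lipschitz constant `c < 1` makes both coordinates strictly increasing.
  obtain ⟨d, hd, hle₀, hle, heq⟩ := exists_min_lipschitz S
    (fun p x => p.2 - p.1 - (1 - c) + c * |x - (p.1 + p.2)|) (fun x => c * min x (2 - x)) c
    (fun p _ x y => by
      rw [add_sub_add_left_eq_sub, ← mul_sub, abs_mul, abs_of_pos hc0]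
      refine mul_le_mul_of_nonneg_left ((abs_abs_sub_abs_le _ _).trans (le_of_eq ?_)) hc0.le
      congr 1
      ring)
    (fun x y => by
      rw [← mul_sub, abs_mul, abs_of_pos hc0]
      refine mul_le_mul_of_nonneg_left ((abs_min_sub_min_le_max _ _ _ _).trans ?_) hc0.le
      refine max_le le_rfl (le_of_eq ?_)
      rw [show 2 - x - (2 - y) = -(x - y) by ring, abs_neg])
  have hstrict : ∀ x y, x < y → |d y - d x| < y - x := by
    intro x y hxy
    refine (hd y x).trans_lt ?_
    rw [abs_of_pos (sub_pos.2 hxy)]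
    nlinarith
  have hdc : Continuous d := by
    refine (LipschitzWith.of_dist_le_mul (K := ⟨c, hc0.le⟩) fun x y => ?_).continuous
    exact hd x y
  have ht : StrictMono fun u => (2 * u - d (2 * u)) / 2 := by
    intro u v huv
    have := abs_lt.1 (hstrict (2 * u) (2 * v) (by linarith))
    simp only
    linarith
  have hs : StrictMono fun u => (2 * u + d (2 * u)) / 2 := by
    intro u v huv
    have := abs_lt.1 (hstrict (2 * u) (2 * v) (by linarith))
    simp only
    linarith
  have d0 : d 0 = 0 := by
    rcases heq 0 with h | ⟨p, hp, h⟩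
    · simpa using h
    · have h0 := hle₀ 0
      obtain ⟨h1, h2, h3, h4⟩ := hP p (hS hp)
      rw [zero_sub, abs_neg, abs_of_pos (by linarith)] at h
      rw [min_eq_left (by norm_num), mul_zero] at h0
      linarith [(hpos p hp).1]
  have d2 : d 2 = 0 := by
    rcases heq 2 with h | ⟨p, hp, h⟩
    · simpa using h
    · have h0 := hle₀ 2
      obtain ⟨h1, h2, h3, h4⟩ := hP p (hS hp)
      rw [abs_of_pos (by linarith)] at h
      rw [min_eq_right (by norm_num), sub_self, mul_zero] at h0
      linarith [(hpos p hp).2]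
  refine ⟨_, _, ⟨by fun_prop, by fun_prop, ?_, ?_, ?_, ?_⟩, ht, hs⟩
  · intro u hu
    have a1 := ht.monotone hu.1
    have a2 := ht.monotone hu.2
    have a3 := hs.monotone hu.1
    have a4 := hs.monotone hu.2
    simp only [mul_zero, mul_one, d0, d2] at a1 a2 a3 a4
    refine ⟨⟨?_, ?_⟩, ?_, ?_⟩ <;> linarith
  · intro u _
    ring
  · intro p hp u _ hu
    have := hle p hp (2 * u)
    rw [hu, sub_self, abs_zero, mul_zero, add_zero, ← hu] at this
    linarith
  · intro p hp hpS u _ hu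
    have key : p.2 - p.1 < d (2 * u) := by
      rcases heq (2 * u) with h | ⟨q, hq, h⟩
      · rw [h, hu]; exact hin p hp
      · rw [h, hu]; exact hsep q hq p hp hpS
    linarith

/-! ### Simultaneous traversals with prescribed winding -/

/-- If two curves have `2 k` common points which appear in the same order on both of them, then
they can be traversed simultaneously so that they do not collide and the direction from one to the
other makes exactly `k` full turns. -/
theorem exists_paths_winding {L R : ℝ → ℂ} (hL : ContinuousOn L (Icc 0 1))
    (hR : ContinuousOn R (Icc 0 1)) (P : Finset (ℝ × ℝ))
    (hPmem : ∀ q ∈ unitSquare, R q.2 = L q.1 ↔ q ∈ P)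
    (hP : ∀ p ∈ P, 0 < p.1 ∧ p.1 < 1 ∧ 0 < p.2 ∧ p.2 < 1)
    (htr : ∀ p ∈ P, ∃ u v : ℂ, HasDerivAt L u p.1 ∧ HasDerivAt R v p.2 ∧
      u.re * v.im - u.im * v.re ≠ 0)
    (hleft : ∀ s ∈ Icc (0 : ℝ) 1, R s - L 0 ∈ Complex.slitPlane)
    (htop : ∀ t ∈ Icc (0 : ℝ) 1, R 1 - L t ∈ Complex.slitPlane)
    (C : Finset (ℝ × ℝ)) (hCP : C ⊆ P)
    (hC : ∀ p ∈ C, ∀ q ∈ C, p ≠ q → (p.1 < q.1 ∧ p.2 < q.2) ∨ (q.1 < p.1 ∧ q.2 < p.2))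
    (k : ℕ) (hk : C.card = 2 * k) :
    ∃ (S : Finset (ℝ × ℝ)) (t s : ℝ → ℝ), IsSeparatingPath P S t s ∧ StrictMono t ∧ StrictMono s ∧
      ∃ (h : ℝ → ℂ) (n : ℤ), ContinuousOn h (Icc 0 1) ∧
        (∀ u ∈ Icc (0 : ℝ) 1, R (s u) - L (t u) = Complex.exp (h u)) ∧ |n| = k ∧
        (h 1).im - (h 0).im = (R 1 - L 1).arg - (R 0 - L 0).arg + 2 * Real.pi * n := by
  classical
  have hlin : ∀ p, ∃ κ : ℂ, p ∈ P → κ.im ≠ 0 ∧ ∃ c : ℂ, c ≠ 0 ∧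
      Filter.Tendsto (fun q : ℝ × ℝ => (R q.2 - L q.1) / linFactor κ p q)
        (nhdsWithin p {p}ᶜ) (nhds c) := by
    intro p
    by_cases hp : p ∈ P
    · obtain ⟨u, v, hu, hv, huv⟩ := htr p hp
      obtain ⟨h1, h2, h3, h4⟩ := hP p hp
      obtain ⟨κ, h⟩ := exists_tendsto_div_linFactor hu hv
        ((hPmem p ⟨⟨h1.le, h2.le⟩, h3.le, h4.le⟩).2 hp) huv
      exact ⟨κ, fun _ => h⟩
    · exact ⟨0, fun h => absurd h hp⟩
  choose κ hκ using hlin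
  have hFc : ContinuousOn (fun q : ℝ × ℝ => R q.2 - L q.1) unitSquare :=
    (hR.comp continuousOn_snd fun q hq => hq.2).sub (hL.comp continuousOn_fst fun q hq => hq.1)
  obtain ⟨g, hg, hgF⟩ := exists_log_mul_prod (fun p => linFactor (κ p) p)
    (fun p => continuous_linFactor _ p) P (fun p hp => linFactor_eq_zero_iff (hκ p hp).1 p)
    (fun q => R q.2 - L q.1) hFc (fun q hq h0 => (hPmem q hq).1 (sub_eq_zero.1 h0))
    (fun p hp => by
      obtain ⟨-, c, hc, hlim⟩ := hκ p hp
      exact ⟨c, hc, hlim.mono_left (nhdsWithin_mono p fun x hx => hx.2)⟩)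
  have hP' : ∀ p ∈ P, 0 < p.1 + p.2 ∧ p.1 + p.2 < 2 := fun p hp => by
    obtain ⟨h1, h2, h3, h4⟩ := hP p hp
    constructor <;> linarith
  have hκ' : ∀ p ∈ P, (κ p).im ≠ 0 := fun p hp => (hκ p hp).1
  have hbd := isSeparatingPath_boundary hP
  obtain ⟨h₀, hc₀, he₀, hv₀⟩ := hbd.exists_log (Finset.empty_subset P) hκ' hP' hg hgF
  have hslit : ∀ u ∈ Icc (0 : ℝ) 1,
      R (min 1 (2 * u)) - L (max 0 (2 * u - 1)) ∈ Complex.slitPlane := by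
    intro u hu
    rcases le_total (2 * u) 1 with h | h
    · rw [max_eq_left (by linarith)]
      exact hleft _ (hbd.mem u hu).2
    · rw [min_eq_left h]
      exact htop _ (hbd.mem u hu).1
  -- Along the left and top sides the principal logarithm is continuous; this evaluates the
  -- contribution of `g` and the factors common to all separating paths.
  have hbase := im_sub_im_eq_of_exp_eq zero_le_one hc₀
    (h' := fun u => Complex.log (R (min 1 (2 * u)) - L (max 0 (2 * u - 1))))
    ((hFc.comp (hbd.continuousOn_fst.prodMk hbd.continuousOn_snd) hbd.mem).clog hslit)
    (fun u hu => by rw [← he₀ u hu, Complex.exp_log (Complex.slitPlane_ne_zero (hslit u hu))])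
  rw [hv₀, Finset.sum_empty] at hbase
  -- In the order "up and left", a set of points increasing in both coordinates is an antichain.
  let : PartialOrder (ℝ × ℝ) := PartialOrder.lift (β := ℝᵒᵈ × ℝ)
    (fun p => (OrderDual.toDual p.1, p.2)) fun p q h => by
      simpa [Prod.ext_iff] using h
  obtain ⟨S, hS, hup, hsum⟩ := exists_upper_subset_abs_sum_eq P C
    (ε := fun p => crossingIndex (κ p)) (fun p => by simp only [crossingIndex]; split_ifs <;> simp)
    hCP (by
      intro p hp q hq hpq hle
      have h1 : q.1 ≤ p.1 := hle.1
      have h2 : p.2 ≤ q.2 := hle.2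
      rcases hC p hp q hq hpq with h | h <;> linarith [h.1, h.2]) k hk
  obtain ⟨t, s, hpath, ht, hs⟩ := exists_strictMono_isSeparatingPath hS hP
    fun p hp q hq h1 h2 => hup p hp q hq ⟨h1, h2⟩
  obtain ⟨h, hc, he, hv⟩ := hpath.exists_log hS hκ' hP' hg hgF
  refine ⟨S, t, s, hpath, ht, hs, h, _, hc, he, hsum, ?_⟩
  rw [hv, ← Complex.log_im, ← Complex.log_im]
  norm_num at hbase
  rw [Finset.sum_sub_distrib]
  linarith

/-! ### Signs of the crossings with a vertical line -/

theorem halfTurns_sub_of_crossing {θ : ℝ → ℝ} {z : ℝ} (hθ : ContinuousAt θ z)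
    (h0 : Real.cos (θ z) = 0) {e : ℤ} (he : e = 1 ∨ e = -1) {r : ℝ} (hr : 0 < r)
    (hb : ∀ w ∈ Ioo (z - r) z, 0 < e * Real.cos (θ w))
    (ha : ∀ w ∈ Ioo z (z + r), e * Real.cos (θ w) < 0) :
    ∃ δ > 0, ∀ w ∈ Ioo (z - δ) z, ∀ w' ∈ Ioo z (z + δ),
      halfTurns (θ w') - halfTurns (θ w) = e * (if 0 < Real.sin (θ z) then 1 else -1) := by
  obtain ⟨δ, hδ, hclose⟩ := Metric.continuousAt_iff.1 hθ (Real.pi / 2) Real.pi_div_two_pos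
  obtain ⟨n, hn⟩ := Real.cos_eq_zero_iff.1 h0
  -- As `cos (θ z) = 0`, the sign of the cosine near `z` tells on which side of `θ z` the angle
  -- lies.
  have hcos : ∀ w, Real.cos (θ w) = -(Real.sin (θ w - θ z) * Real.sin (θ z)) := by
    intro w
    have := Real.cos_add (θ w - θ z) (θ z)
    rw [sub_add_cancel, h0] at this
    linarith
  have hsq := Real.sin_sq_add_cos_sq (θ z)
  rw [h0] at hsq
  have hpos : ∀ x : ℝ, |x| < Real.pi / 2 → 0 < Real.sin x → 0 < x := by
    intro x hx hs
    by_contra! hc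
    have := Real.sin_nonpos_of_nonpos_of_neg_pi_le hc (by linarith [(abs_lt.1 hx).1, Real.pi_pos])
    linarith
  have hneg : ∀ x : ℝ, |x| < Real.pi / 2 → Real.sin x < 0 → x < 0 := by
    intro x hx hs
    by_contra! hc
    have := Real.sin_nonneg_of_nonneg_of_le_pi hc (by linarith [(abs_lt.1 hx).2, Real.pi_pos])
    linarith
  have low : ∀ w, |θ w - θ z| < Real.pi / 2 → θ w - θ z < 0 → halfTurns (θ w) = n := by
    intro w h1 h2
    apply halfTurns_eq_of_abs_lt
    rw [abs_lt] at h1 ⊢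
    constructor <;> linarith
  have high : ∀ w, |θ w - θ z| < Real.pi / 2 → 0 < θ w - θ z → halfTurns (θ w) = n + 1 := by
    intro w h1 h2
    apply halfTurns_eq_of_abs_lt
    rw [abs_lt] at h1 ⊢
    push_cast
    constructor <;> linarith
  refine ⟨min δ r, lt_min hδ hr, fun w hw w' hw' => ?_⟩
  have m1 := min_le_left δ r
  have m2 := min_le_right δ r
  have c1 : |θ w - θ z| < Real.pi / 2 := hclose (by
    rw [Real.dist_eq, abs_lt]; constructor <;> linarith [hw.1, hw.2])
  have c2 : |θ w' - θ z| < Real.pi / 2 := hclose (by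
    rw [Real.dist_eq, abs_lt]; constructor <;> linarith [hw'.1, hw'.2])
  have b := hb w ⟨by linarith [hw.1], hw.2⟩
  have a := ha w' ⟨hw'.1, by linarith [hw'.2]⟩
  rw [hcos] at a b
  split_ifs with hs
  · have hs1 : Real.sin (θ z) = 1 := by nlinarith
    rw [hs1] at a b
    rcases he with rfl | rfl
    · rw [low w c1 (hneg _ c1 (by push_cast at b; linarith)),
        high w' c2 (hpos _ c2 (by push_cast at a; linarith))]
      ring
    · rw [high w c1 (hpos _ c1 (by push_cast at b; linarith)),
        low w' c2 (hneg _ c2 (by push_cast at a; linarith))]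
      ring
  · have hs1 : Real.sin (θ z) = -1 := by nlinarith
    rw [hs1] at a b
    rcases he with rfl | rfl
    · rw [high w c1 (hpos _ c1 (by push_cast at b; linarith)),
        low w' c2 (hneg _ c2 (by push_cast at a; linarith))]
      ring
    · rw [low w c1 (hneg _ c1 (by push_cast at b; linarith)),
        high w' c2 (hpos _ c2 (by push_cast at a; linarith))]
      ring

/-- The number of half turns of a continuous angle is the sum of the signs of its passages through
the vertical direction. -/
theorem sum_sign_eq_halfTurns_sub {θ : ℝ → ℝ} {a : ℝ} {sgn : ℝ → ℤ} (Z : Finset ℝ) {b : ℝ}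
    (hab : a ≤ b) (hθ : ContinuousOn θ (Icc a b))
    (hZ : ∀ z ∈ Icc a b, Real.cos (θ z) = 0 ↔ z ∈ Z) (hZab : ∀ z ∈ Z, z ∈ Ioo a b)
    (hsgn : ∀ z ∈ Z, ∃ e : ℤ, (e = 1 ∨ e = -1) ∧
      sgn z = e * (if 0 < Real.sin (θ z) then 1 else -1) ∧ ∃ r > 0,
        (∀ w ∈ Ioo (z - r) z, 0 < e * Real.cos (θ w)) ∧
        ∀ w ∈ Ioo z (z + r), e * Real.cos (θ w) < 0) :
    ∑ z ∈ Z, sgn z = halfTurns (θ b) - halfTurns (θ a) := by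
  classical
  induction Z using Finset.induction_on_max generalizing b with
  | empty =>
    rw [halfTurns_eq_of_cos_ne_zero (a := a) (b := b) (by rwa [uIcc_of_le hab]), sub_self,
      Finset.sum_empty]
    rw [uIcc_of_le hab]
    intro z hz h
    simpa using (hZ z hz).1 h
  | insert z Z hmax ih =>
    have hzZ : z ∉ Z := fun h => lt_irrefl _ (hmax z h)
    obtain ⟨haz, hzb⟩ := hZab z (Finset.mem_insert_self _ _)
    have hzmem : z ∈ Icc a b := ⟨haz.le, hzb.le⟩
    obtain ⟨e, he, hsgnz, r, hr, hbef, haft⟩ := hsgn z (Finset.mem_insert_self _ _)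
    obtain ⟨δ, hδ, hjump⟩ := halfTurns_sub_of_crossing
      (hθ.continuousAt (Icc_mem_nhds haz hzb)) ((hZ z hzmem).2 (Finset.mem_insert_self _ _))
      he hr hbef haft
    -- Sample points `w` and `w'` just before and after the last crossing `z`: induction covers `[a,
    -- w]`, the jump occurs between them, and no half turn occurs on `[w', b]`.
    have hev : ∀ᶠ w in nhdsWithin z (Iio z), w ∈ Ioo (z - δ) z ∧ a < w ∧ ∀ y ∈ Z, y < w := by
      refine Filter.Eventually.and (Ioo_mem_nhdsLT (by linarith)) (Filter.Eventually.and ?_ ?_)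
      · exact nhdsWithin_le_nhds (lt_mem_nhds haz)
      · rw [Filter.eventually_all_finset]
        exact fun y hy => nhdsWithin_le_nhds (lt_mem_nhds (hmax y hy))
    obtain ⟨w, hw, haw, hwZ⟩ := hev.exists
    have hwb : w < b := hw.2.trans hzb
    obtain ⟨w', hw'⟩ : (Ioo z (min (z + δ) b)).Nonempty :=
      nonempty_Ioo.2 (lt_min (by linarith) hzb)
    have hw'b : w' < b := hw'.2.trans_le (min_le_right _ _)
    have h1 := ih haw.le (hθ.mono (Icc_subset_Icc_right hwb.le))
      (fun y hy => by
        rw [hZ y ⟨hy.1, hy.2.trans hwb.le⟩, Finset.mem_insert, or_iff_right]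
        rintro rfl
        exact absurd hw.2 (not_lt.2 hy.2))
      (fun y hy => ⟨(hZab y (Finset.mem_insert_of_mem hy)).1, hwZ y hy⟩)
      (fun y hy => hsgn y (Finset.mem_insert_of_mem hy))
    have h2 := hjump w hw w' ⟨hw'.1, hw'.2.trans_le (min_le_left _ _)⟩
    have h3 : halfTurns (θ w') = halfTurns (θ b) := by
      have hsub : Icc w' b ⊆ Icc a b := Icc_subset_Icc_left (haz.le.trans hw'.1.le)
      apply halfTurns_eq_of_cos_ne_zero
      · rw [uIcc_of_le hw'b.le]
        exact hθ.mono hsub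
      · rw [uIcc_of_le hw'b.le]
        intro y hy h
        have hyz : z < y := hw'.1.trans_le hy.1
        rcases Finset.mem_insert.1 ((hZ y (hsub hy)).1 h) with h | h
        · exact hyz.ne' h
        · exact lt_asymm hyz (hmax y h)
    rw [Finset.sum_insert hzZ, h1, hsgnz]
    linarith

/-! ### Heights on `z`-monotone tangles -/

theorem atHeight_eq {s : C(I, Space)} {u : I} {z : ℝ} (hz : (s u).2 = z)
    (h : ∃! p, p ∈ range s ∧ p.2 = z) : atHeight s z = (s u).1 := by
  have hex : ∃ u, (s u).2 = z := ⟨u, hz⟩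
  rw [atHeight, dif_pos hex]
  rw [h.unique ⟨mem_range_self _, hex.choose_spec⟩ ⟨mem_range_self u, hz⟩]

theorem exists_apply_eq_atHeight {s : C(I, Space)} {z : ℝ}
    (h : ∃! p, p ∈ range s ∧ p.2 = z) : ∃ u, s u = (atHeight s z, z) := by
  obtain ⟨p, ⟨⟨u, rfl⟩, hz⟩, -⟩ := id h
  exact ⟨u, by rw [atHeight_eq hz h, ← hz]⟩

/-- Monotonicity makes the height a continuous bijection from a compact space to a Hausdorff one, so
its inverse is continuous. -/
theorem continuousOn_atHeight {s : C(I, Space)} (hinj : Function.Injective s)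
    (hmem : ∀ u, s u ∈ cylinder) (h : ∀ z ∈ Icc (0 : ℝ) 3, ∃! p, p ∈ range s ∧ p.2 = z) :
    ContinuousOn (atHeight s) (Icc 0 3) := by
  let f : I → Icc (0 : ℝ) 3 := fun u => ⟨(s u).2, (hmem u).2⟩
  have hf : Continuous f := by
    refine Continuous.subtype_mk ?_ _
    fun_prop
  have hbij : Function.Bijective f := by
    constructor
    · intro u v huv
      apply hinj
      exact (h _ (hmem v).2).unique ⟨mem_range_self _, congrArg Subtype.val huv⟩
        ⟨mem_range_self _, rfl⟩
    · rintro ⟨z, hz⟩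
      obtain ⟨u, hu⟩ := exists_apply_eq_atHeight (h z hz)
      exact ⟨u, Subtype.ext (by simp [f, hu])⟩
  let e := hf.homeoOfEquivCompactToT2 (f := Equiv.ofBijective f hbij)
  rw [continuousOn_iff_continuous_domRestrict]
  have : (Icc (0 : ℝ) 3).domRestrict (atHeight s) = fun z => (s (e.symm z)).1 := by
    ext1 z
    refine atHeight_eq ?_ (h z z.2)
    exact congrArg Subtype.val (e.apply_symm_apply z)
  rw [this]
  fun_prop

namespace Tangle

/-- The vector from the left string to the right string at height `z`. -/
def gap (T : Tangle) (z : ℝ) : ℂ :=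
  ⟨(atHeight T.rho z).1 - (atHeight T.lam z).1, (atHeight T.rho z).2 - (atHeight T.lam z).2⟩

theorem continuousOn_gap {T : Tangle} (hT : T.IsZMonotone) : ContinuousOn T.gap (Icc 0 3) := by
  have h1 := continuousOn_atHeight T.lam_injective T.lam_mem fun z hz => (hT z hz).1
  have h2 := continuousOn_atHeight T.rho_injective T.rho_mem fun z hz => (hT z hz).2
  have : T.gap = fun z => Complex.equivRealProdCLM.symm (atHeight T.rho z - atHeight T.lam z) := by
    ext1 z
    apply Complex.ext <;> simp [gap]
  rw [this]
  exact Complex.equivRealProdCLM.symm.continuous.comp_continuousOn (h2.sub h1)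

theorem gap_ne_zero {T : Tangle} (hT : T.IsZMonotone) {z : ℝ} (hz : z ∈ Icc (0 : ℝ) 3) :
    T.gap z ≠ 0 := by
  intro h
  obtain ⟨u, hu⟩ := exists_apply_eq_atHeight (hT z hz).1
  obtain ⟨v, hv⟩ := exists_apply_eq_atHeight (hT z hz).2
  have h1 := congrArg Complex.re h
  have h2 := congrArg Complex.im h
  simp only [gap, Complex.zero_re, Complex.zero_im] at h1 h2
  have : atHeight T.lam z = atHeight T.rho z := by
    ext <;> linarith
  exact disjoint_left.1 T.disjoint ⟨u, rfl⟩ ⟨v, by rw [hu, hv, this]⟩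

/-- In polar form the diagram crosses where the cosine of the argument of the gap vanishes, the sign
of the sine tells which strand is in front, and the change of sign of the cosine tells the
direction. The signs thus add up to the half turns. -/
theorem diagramIndex_eq {T : Tangle} (hreg : T.IsVerticallyRegular)
    {h : ℝ → ℂ} (hc : ContinuousOn h (Icc 0 3))
    (he : ∀ z ∈ Icc (0 : ℝ) 3, T.gap z = Complex.exp (h z)) :
    T.diagramIndex = (1 / 2) * ((halfTurns (h 3).im - halfTurns (h 0).im : ℤ) : ℚ) := by
  classical
  obtain ⟨hfin, hcross⟩ := hreg
  have hre : ∀ z ∈ Icc (0 : ℝ) 3, (atHeight T.rho z).1 - (atHeight T.lam z).1 =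
      Real.exp (h z).re * Real.cos (h z).im := fun z hz => by
    rw [← Complex.exp_re, ← he z hz, gap]
  have him : ∀ z ∈ Icc (0 : ℝ) 3, (atHeight T.rho z).2 - (atHeight T.lam z).2 =
      Real.exp (h z).re * Real.sin (h z).im := fun z hz => by
    rw [← Complex.exp_im, ← he z hz, gap]
  let sgn : ℝ → ℤ := fun z => (if (atHeight T.lam z).2 < (atHeight T.rho z).2 then 1 else -1) *
    (if CrossesRight (fun w => (atHeight T.lam w).1) (fun w => (atHeight T.rho w).1) z
      then 1 else -1)
  have hsgn : ∀ z, T.crossingSign z = (sgn z : ℚ) := by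
    intro z
    simp only [crossingSign, sgn]
    push_cast
    rfl
  have key := sum_sign_eq_halfTurns_sub (θ := fun z => (h z).im) (a := 0) (b := 3) (sgn := sgn)
    hfin.toFinset (by norm_num) (Complex.continuous_im.comp_continuousOn hc) ?_ ?_ ?_
  · rw [diagramIndex, finsum_mem_eq_finite_toFinset_sum _ hfin,
      Finset.sum_congr rfl fun z _ => hsgn z, ← Int.cast_sum, key]
  · intro z hz
    rw [hfin.mem_toFinset, verticalCrossings, mem_ofPred_eq, and_iff_right hz, eq_comm (b := Prod.fst _),
      ← sub_eq_zero (a := (atHeight T.rho z).1), hre z hz, mul_eq_zero,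
      or_iff_right (Real.exp_ne_zero _)]
  · intro z hz
    exact (hcross z (hfin.mem_toFinset.1 hz)).1
  · intro z hz
    obtain ⟨hz03, hcr⟩ := hcross z (hfin.mem_toFinset.1 hz)
    have hzI : z ∈ Icc (0 : ℝ) 3 := Ioo_subset_Icc_self hz03
    have hy : ((atHeight T.lam z).2 < (atHeight T.rho z).2) = (0 < Real.sin (h z).im) := by
      rw [← sub_pos, him z hzI, mul_pos_iff_of_pos_left (Real.exp_pos _)]
    have hlt : ∀ w ∈ Icc (0 : ℝ) 3, ((atHeight T.lam w).1 < (atHeight T.rho w).1 ↔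
        0 < Real.cos (h w).im) := fun w hw => by
      rw [← sub_pos, hre w hw, mul_pos_iff_of_pos_left (Real.exp_pos _)]
    have hgt : ∀ w ∈ Icc (0 : ℝ) 3, ((atHeight T.rho w).1 < (atHeight T.lam w).1 ↔
        Real.cos (h w).im < 0) := fun w hw => by
      rw [← sub_neg, hre w hw, mul_neg_iff, and_iff_right (Real.exp_pos _),
        or_iff_left fun h => lt_asymm h.1 (Real.exp_pos _)]
    have hmin : ∀ r > 0, 0 < min r (min z (3 - z)) := fun r hr =>
      lt_min hr (lt_min hz03.1 (by linarith [hz03.2]))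
    have hI : ∀ r w, w ∈ Ioo (z - min r (min z (3 - z))) (z + min r (min z (3 - z))) →
        w ∈ Icc (0 : ℝ) 3 ∧ w ∈ Ioo (z - r) (z + r) := by
      intro r w hw
      have e1 := min_le_left r (min z (3 - z))
      have e2 := (min_le_right r (min z (3 - z))).trans (min_le_left _ _)
      have e3 := (min_le_right r (min z (3 - z))).trans (min_le_right _ _)
      refine ⟨⟨?_, ?_⟩, ?_, ?_⟩ <;> linarith [hw.1, hw.2]
    by_cases hright : CrossesRight (fun w => (atHeight T.lam w).1)
        (fun w => (atHeight T.rho w).1) z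
    · refine ⟨1, Or.inl rfl, ?_, ?_⟩
      · simp only [sgn, if_pos hright, hy, one_mul, mul_one]
      · obtain ⟨r, hr, hb, ha⟩ := hright
        refine ⟨_, hmin r hr, fun w hw => ?_, fun w hw => ?_⟩
        · obtain ⟨i1, i2⟩ := hI r w ⟨hw.1, by linarith [hw.2, hmin r hr]⟩
          rw [Int.cast_one, one_mul, ← hlt w i1]
          exact hb w ⟨i2.1, hw.2⟩
        · obtain ⟨i1, i2⟩ := hI r w ⟨by linarith [hw.1, hmin r hr], hw.2⟩
          rw [Int.cast_one, one_mul, ← hgt w i1]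
          exact ha w ⟨hw.1, i2.2⟩
    · refine ⟨-1, Or.inr rfl, ?_, ?_⟩
      · simp only [sgn, if_neg hright, hy, mul_comm]
      · obtain ⟨r, hr, hb, ha⟩ := hcr.resolve_left hright
        refine ⟨_, hmin r hr, fun w hw => ?_, fun w hw => ?_⟩
        · obtain ⟨i1, i2⟩ := hI r w ⟨hw.1, by linarith [hw.2, hmin r hr]⟩
          have := (hgt w i1).1 (hb w ⟨i2.1, hw.2⟩)
          push_cast
          linarith
        · obtain ⟨i1, i2⟩ := hI r w ⟨by linarith [hw.1, hmin r hr], hw.2⟩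
          have := (hlt w i1).1 (ha w ⟨hw.1, i2.2⟩)
          push_cast
          linarith

/-- The linking index in terms of the variation of the argument of the gap between the strings. -/
theorem hasLinkingIndex_of_log {T : Tangle} (hT : T.IsZMonotone)
    (hl₀ : (T.lam 0).2 = 0) (hl₃ : (T.lam 1).2 = 3) (hr₀ : (T.rho 0).2 = 0)
    (hr₃ : (T.rho 1).2 = 3) (happrox : ∀ ε > 0, ∃ T', T.IsRegularApprox T' ε)
    {h : ℝ → ℂ} (hc : ContinuousOn h (Icc 0 3))
    (he : ∀ z ∈ Icc (0 : ℝ) 3, T.gap z = Complex.exp (h z)) :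
    T.HasLinkingIndex ((1 / 2) * ((halfTurns (h 3).im - halfTurns (h 0).im : ℤ) : ℚ)) := by
  refine ⟨happrox, ?_⟩
  obtain ⟨z₀, hz₀, hmin⟩ := isCompact_Icc.exists_isMinOn (nonempty_Icc.2 (by norm_num))
    (continuousOn_gap hT).norm
  have hpos : 0 < ‖T.gap z₀‖ := norm_pos_iff.2 (gap_ne_zero hT hz₀)
  -- The two gaps differ by at most the sum of four coordinate errors, hence by less than the
  -- minimal length of the gap of `T`.
  refine ⟨‖T.gap z₀‖ / 4, by positivity, fun T' hT' => ?_⟩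
  obtain ⟨hT'm, hreg, hl0, hl1, hr0, hr1, hclose⟩ := hT'
  have hratio : ∀ z ∈ Icc (0 : ℝ) 3, T'.gap z / T.gap z ∈ Complex.slitPlane := by
    intro z hz
    have hne := gap_ne_zero hT hz
    obtain ⟨d1, d2⟩ := hclose z hz
    rw [Prod.dist_eq, max_lt_iff, Real.dist_eq, Real.dist_eq] at d1 d2
    have hsub : ‖T'.gap z - T.gap z‖ < ‖T.gap z₀‖ := by
      refine (Complex.norm_le_abs_re_add_abs_im _).trans_lt ?_
      have e1 := abs_sub ((atHeight T'.rho z).1 - (atHeight T.rho z).1)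
        ((atHeight T'.lam z).1 - (atHeight T.lam z).1)
      have e2 := abs_sub ((atHeight T'.rho z).2 - (atHeight T.rho z).2)
        ((atHeight T'.lam z).2 - (atHeight T.lam z).2)
      rw [sub_sub_sub_comm] at e1 e2
      have r1 : (T'.gap z - T.gap z).re = (atHeight T'.rho z).1 - (atHeight T'.lam z).1 -
          ((atHeight T.rho z).1 - (atHeight T.lam z).1) := rfl
      have r2 : (T'.gap z - T.gap z).im = (atHeight T'.rho z).2 - (atHeight T'.lam z).2 -
          ((atHeight T.rho z).2 - (atHeight T.lam z).2) := rfl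
      rw [r1, r2]
      linarith [d1.1, d1.2, d2.1, d2.2]
    rw [show T'.gap z / T.gap z = 1 + (T'.gap z - T.gap z) / T.gap z by field_simp; ring]
    apply Complex.mem_slitPlane_of_norm_lt_one
    rw [norm_div, div_lt_one (norm_pos_iff.2 hne)]
    exact hsub.trans_le (hmin hz)
  have hends : ∀ u z, (T.lam u).2 = z → (T.rho u).2 = z → z ∈ Icc (0 : ℝ) 3 →
      T'.lam u = T.lam u → T'.rho u = T.rho u → T'.gap z / T.gap z = 1 := by
    intro u z h1 h2 hz h3 h4
    rw [gap, atHeight_eq (h3 ▸ h1) (hT'm z hz).1, atHeight_eq (h4 ▸ h2) (hT'm z hz).2, h3, h4,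
      ← atHeight_eq h1 (hT z hz).1, ← atHeight_eq h2 (hT z hz).2]
    exact div_self (gap_ne_zero hT hz)
  -- The ratio of the gaps avoids the negative axis and is `1` at both ends, so its principal
  -- logarithm corrects `h` without changing the end values.
  rw [diagramIndex_eq hreg (h := fun z => h z + Complex.log (T'.gap z / T.gap z))]
  · rw [hends 0 0 hl₀ hr₀ (by simp) hl0 hr0, hends 1 3 hl₃ hr₃ (by simp) hl1 hr1,
      Complex.log_one, add_zero, add_zero]
  · exact hc.add (((continuousOn_gap hT'm).div (continuousOn_gap hT)
      fun z hz => gap_ne_zero hT hz).clog hratio)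
  · intro z hz
    rw [Complex.exp_add, ← he z hz, Complex.exp_log (Complex.slitPlane_ne_zero (hratio z hz)),
      mul_div_cancel₀ _ (gap_ne_zero hT hz)]

end Tangle

/-! ### Auxiliary results on polynomials and on the disk -/

theorem convex_disk : Convex ℝ disk := by
  intro p hp q hq a b ha hb hab
  have hsq : ∀ x y : ℝ, (a * x + b * y) ^ 2 ≤ a * x ^ 2 + b * y ^ 2 := by
    intro x y
    have hb' : b = 1 - a := by linarith
    have : 0 ≤ a * b * (x - y) ^ 2 := by positivity
    subst hb'
    nlinarith
  have h1 := hsq p.1 q.1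
  have h2 := hsq p.2 q.2
  simp only [disk, mem_ofPred_eq, Prod.fst_add, Prod.snd_add, Prod.smul_fst, Prod.smul_snd,
    smul_eq_mul] at hp hq ⊢
  nlinarith

/-- At a simple zero the sign of a polynomial changes. -/
theorem Polynomial.exists_sign_change {E : Polynomial ℝ} {x : ℝ} (h0 : E.eval x = 0)
    (h1 : 0 < E.derivative.eval x) :
    ∃ δ > 0, (∀ y ∈ Ioo (x - δ) x, E.eval y < 0) ∧ ∀ y ∈ Ioo x (x + δ), 0 < E.eval y := by
  have hd : 0 < deriv (fun y => E.eval y) x := by rwa [Polynomial.deriv]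
  obtain ⟨δ, hδ, h⟩ := Metric.eventually_nhds_iff.1
    (eventually_nhdsWithin_sign_eq_of_deriv_pos hd h0)
  refine ⟨δ, hδ, fun y hy => ?_, fun y hy => ?_⟩
  · have := h (y := y) (by rw [Real.dist_eq, abs_lt]; constructor <;> linarith [hy.1, hy.2])
    rwa [sign_neg (sub_neg.2 hy.2), sign_eq_neg_one_iff] at this
  · have := h (y := y) (by rw [Real.dist_eq, abs_lt]; constructor <;> linarith [hy.1, hy.2])
    rwa [sign_pos (sub_pos.2 hy.1), sign_eq_one_iff] at this

open Polynomial in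
/-- Subtracting a generic small multiple of `X (1 - X)` makes all zeros in `(0, 1)` simple. -/
theorem Polynomial.exists_sub_simple_zeros {D : ℝ[X]} (h0 : D.eval 0 ≠ 0) {η : ℝ}
    (hη : 0 < η) : ∃ q ∈ Icc (-1 : ℝ) 1, ∀ x ∈ Ioo (0 : ℝ) 1,
      (D - C (q * η) * (X * (1 - X))).eval x = 0 →
        (derivative (D - C (q * η) * (X * (1 - X)))).eval x ≠ 0 := by
  let B : ℝ[X] := X * (1 - X)
  -- Numerator of the derivative of `D / B`. A multiple zero in `(0, 1)` would make `q` a critical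
  -- value of `D / (η B)`, and there are only finitely many since `K` equals `-D` at `0`.
  let K : ℝ[X] := derivative D * B - D * derivative B
  have hK : K ≠ 0 := by
    intro hK
    have := congrArg (eval 0) hK
    simp [K, B] at this
    exact h0 this
  obtain ⟨q, hq, hqbad⟩ := ((Icc_infinite (show (-1 : ℝ) < 1 by norm_num)).sdiff
    ((K.roots.toFinset.finite_toSet).image fun r => D.eval r / (η * B.eval r))).nonempty
  refine ⟨q, hq, fun x hx hE hE' => hqbad ⟨x, ?_, ?_⟩⟩
  · rw [Finset.mem_coe, Multiset.mem_toFinset, mem_roots hK, IsRoot.def]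
    have e1 : D.eval x = q * η * B.eval x := by
      rw [eval_sub, eval_mul, eval_C, sub_eq_zero] at hE
      exact hE
    have e2 : (derivative D).eval x = q * η * (derivative B).eval x := by
      rw [derivative_sub, derivative_C_mul, eval_sub, eval_mul, eval_C, sub_eq_zero] at hE'
      exact hE'
    simp only [K, eval_sub, eval_mul, e1, e2]
    ring
  · have hB : B.eval x ≠ 0 := by
      simp only [B, eval_mul, eval_X, eval_sub, eval_one]
      exact mul_ne_zero hx.1.ne' (by linarith [hx.2])
    rw [eval_sub, eval_mul, eval_C, sub_eq_zero] at hE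
    simp only
    rw [hE, div_eq_iff (mul_ne_zero hη.ne' hB)]
    simp only [B]
    ring

/-- The first coordinate of the Bernstein approximation, as a polynomial. -/
theorem exists_polynomial_bernsteinApproximation_fst (n : ℕ) (a : C(I, ℝ × ℝ)) :
    ∃ p : Polynomial ℝ, ∀ u : I, (bernsteinApproximation n a u).1 = p.eval (u : ℝ) := by
  refine ⟨∑ k : Fin (n + 1), Polynomial.C (a (bernstein.z k)).1 * bernsteinPolynomial ℝ n k,
    fun u => ?_⟩
  rw [bernsteinApproximation.apply, Prod.fst_sum, Polynomial.eval_finsetSum]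
  refine Finset.sum_congr rfl fun k _ => ?_
  rw [Polynomial.eval_mul, Polynomial.eval_C, mul_comm]
  rfl

/-- The Bernstein weights are nonnegative with sum `1`, so each value is a convex combination of
points of the disk. -/
theorem bernsteinApproximation_mem_disk (n : ℕ) {a : C(I, ℝ × ℝ)} (ha : ∀ u, a u ∈ disk)
    (u : I) : bernsteinApproximation n a u ∈ disk := by
  rw [bernsteinApproximation.apply]
  exact convex_disk.sum_mem (fun k _ => bernstein_nonneg) (bernstein.probability n u)
    fun k _ => ha _

/-! ### Tangles parametrized by height -/

namespace Tangle

/-- The string which is at the horizontal position `a u` at height `3 u`. -/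
def graphString (a : C(I, ℝ × ℝ)) : C(I, Space) := ⟨fun u => (a u, 3 * u), by fun_prop⟩

/-- The tangle whose strings are at the horizontal positions `a u` and `b u` at height `3 u`. -/
def ofGraphs (a b : C(I, ℝ × ℝ)) (ha : ∀ u, a u ∈ disk) (hb : ∀ u, b u ∈ disk)
    (hab : ∀ u, a u ≠ b u) : Tangle where
  lam := graphString a
  rho := graphString b
  lam_injective u v h := by
    have := congrArg Prod.snd h
    simp only [graphString, ContinuousMap.coe_mk] at this
    exact Subtype.ext (by linarith)
  rho_injective u v h := by
    have := congrArg Prod.snd h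
    simp only [graphString, ContinuousMap.coe_mk] at this
    exact Subtype.ext (by linarith)
  lam_mem u := ⟨ha u, by constructor <;> simp only [graphString, ContinuousMap.coe_mk] <;>
    linarith [u.2.1, u.2.2]⟩
  rho_mem u := ⟨hb u, by constructor <;> simp only [graphString, ContinuousMap.coe_mk] <;>
    linarith [u.2.1, u.2.2]⟩
  disjoint := by
    rw [disjoint_left]
    rintro _ ⟨u, rfl⟩ ⟨v, hv⟩
    have h1 := congrArg Prod.snd hv
    have h2 := congrArg Prod.fst hv
    simp only [graphString, ContinuousMap.coe_mk] at h1 h2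
    obtain rfl : u = v := Subtype.ext (by linarith)
    exact hab u h2.symm

theorem existsUnique_graphString (a : C(I, ℝ × ℝ)) {z : ℝ} (hz : z ∈ Icc (0 : ℝ) 3) :
    ∃! p, p ∈ range (graphString a) ∧ p.2 = z := by
  have hu : z / 3 ∈ I := ⟨by linarith [hz.1], by linarith [hz.2]⟩
  refine ⟨graphString a ⟨z / 3, hu⟩, ⟨mem_range_self _, ?_⟩, ?_⟩
  · simp only [graphString, ContinuousMap.coe_mk]
    ring
  · rintro _ ⟨⟨u, rfl⟩, h⟩
    simp only [graphString, ContinuousMap.coe_mk] at h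
    congr 1
    exact Subtype.ext (by simp only; linarith)

theorem atHeight_graphString (a : C(I, ℝ × ℝ)) {z : ℝ} (hz : z ∈ Icc (0 : ℝ) 3) :
    atHeight (graphString a) z = a (projIcc 0 1 zero_le_one (z / 3)) := by
  have hu : z / 3 ∈ I := ⟨by linarith [hz.1], by linarith [hz.2]⟩
  rw [projIcc_of_mem zero_le_one hu]
  refine atHeight_eq ?_ (existsUnique_graphString a hz)
  simp only [graphString, ContinuousMap.coe_mk]
  ring

variable {a b : C(I, ℝ × ℝ)} {ha : ∀ u, a u ∈ disk} {hb : ∀ u, b u ∈ disk} {hab : ∀ u, a u ≠ b u}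

theorem isZMonotone_ofGraphs : (ofGraphs a b ha hb hab).IsZMonotone := fun _ hz =>
  ⟨existsUnique_graphString a hz, existsUnique_graphString b hz⟩

/-- A diagram in which the horizontal distance of the strands is a polynomial in the height with
simple zeros is regular. -/
theorem isVerticallyRegular_ofGraphs {E : Polynomial ℝ}
    (hE : ∀ u : I, (b u).1 - (a u).1 = E.eval (u : ℝ)) (h0 : E.eval 0 ≠ 0) (h1 : E.eval 1 ≠ 0)
    (hsimple : ∀ x ∈ Ioo (0 : ℝ) 1, E.eval x = 0 → E.derivative.eval x ≠ 0) :
    (ofGraphs a b ha hb hab).IsVerticallyRegular := by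
  have hdiff : ∀ z ∈ Icc (0 : ℝ) 3, (atHeight (ofGraphs a b ha hb hab).rho z).1 -
      (atHeight (ofGraphs a b ha hb hab).lam z).1 = E.eval (z / 3) := by
    intro z hz
    have hu : z / 3 ∈ I := ⟨by linarith [hz.1], by linarith [hz.2]⟩
    simp only [ofGraphs]
    rw [atHeight_graphString b hz, atHeight_graphString a hz, hE, projIcc_of_mem zero_le_one hu]
  have hzero : ∀ z ∈ (ofGraphs a b ha hb hab).verticalCrossings,
      z ∈ Icc (0 : ℝ) 3 ∧ E.eval (z / 3) = 0 := by
    rintro z ⟨hz, h⟩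
    exact ⟨hz, by rw [← hdiff z hz, h, sub_self]⟩
  refine ⟨?_, fun z hz => ?_⟩
  · have hE0 : E ≠ 0 := by
      rintro rfl
      simp at h0
    refine (((E.roots.toFinset.finite_toSet).image fun x => 3 * x)).subset fun z hz => ?_
    refine ⟨z / 3, ?_, by simp only; ring⟩
    rw [Finset.mem_coe, Multiset.mem_toFinset, Polynomial.mem_roots hE0]
    exact (hzero z hz).2
  · obtain ⟨hz03, hEz⟩ := hzero z hz
    have hz0 : z ≠ 0 := by
      rintro rfl
      exact h0 (by simpa using hEz)
    have hz3 : z ≠ 3 := by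
      rintro rfl
      exact h1 (by simpa using hEz)
    have hzo : z ∈ Ioo (0 : ℝ) 3 := ⟨lt_of_le_of_ne hz03.1 hz0.symm, lt_of_le_of_ne hz03.2 hz3⟩
    refine ⟨hzo, ?_⟩
    have hI : ∀ δ w, w ∈ Ioo (z - min (3 * δ) (min z (3 - z))) (z + min (3 * δ) (min z (3 - z))) →
        w ∈ Icc (0 : ℝ) 3 ∧ z / 3 - δ < w / 3 ∧ w / 3 < z / 3 + δ := by
      intro δ w hw
      have e1 := min_le_left (3 * δ) (min z (3 - z))
      have e2 := (min_le_right (3 * δ) (min z (3 - z))).trans (min_le_left _ _)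
      have e3 := (min_le_right (3 * δ) (min z (3 - z))).trans (min_le_right _ _)
      refine ⟨⟨?_, ?_⟩, ?_, ?_⟩ <;> linarith [hw.1, hw.2]
    have hmin : ∀ δ > 0, 0 < min (3 * δ) (min z (3 - z)) := fun δ hδ =>
      lt_min (by linarith) (lt_min hzo.1 (by linarith [hzo.2]))
    rcases (hsimple (z / 3) ⟨by linarith [hzo.1], by linarith [hzo.2]⟩ hEz).lt_or_gt with h | h
    · left
      obtain ⟨δ, hδ, hbef, haft⟩ := Polynomial.exists_sign_change (E := -E) (x := z / 3)
        (by rw [Polynomial.eval_neg, hEz, neg_zero])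
        (by rw [Polynomial.derivative_neg, Polynomial.eval_neg]; linarith)
      have hm := hmin δ hδ
      refine ⟨_, hm, fun w hw => ?_, fun w hw => ?_⟩
      · obtain ⟨i, i1, i2⟩ := hI δ w ⟨hw.1, by linarith [hw.2]⟩
        have := hbef (w / 3) ⟨i1, by linarith [hw.2]⟩
        rw [Polynomial.eval_neg, ← hdiff w i] at this
        linarith
      · obtain ⟨i, i1, i2⟩ := hI δ w ⟨by linarith [hw.1], hw.2⟩
        have := haft (w / 3) ⟨by linarith [hw.1], i2⟩
        rw [Polynomial.eval_neg, ← hdiff w i] at this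
        linarith
    · right
      obtain ⟨δ, hδ, hbef, haft⟩ := Polynomial.exists_sign_change hEz h
      have hm := hmin δ hδ
      refine ⟨_, hm, fun w hw => ?_, fun w hw => ?_⟩
      · obtain ⟨i, i1, i2⟩ := hI δ w ⟨hw.1, by linarith [hw.2]⟩
        have := hbef (w / 3) ⟨i1, by linarith [hw.2]⟩
        rw [← hdiff w i] at this
        linarith
      · obtain ⟨i, i1, i2⟩ := hI δ w ⟨by linarith [hw.1], hw.2⟩
        have := haft (w / 3) ⟨by linarith [hw.1], i2⟩
        rw [← hdiff w i] at this
        linarith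

/-! ### Regular approximations -/

/-- The curve obtained from `a` by pulling the point of parameter `u` towards `q` with weight
`η u (1 - u)`. -/
def pull (η : ℝ) (q : ℝ × ℝ) (a : C(I, ℝ × ℝ)) : C(I, ℝ × ℝ) :=
  ⟨fun u => (1 - η * (u * (1 - u)) : ℝ) • a u + (η * (u * (1 - u)) : ℝ) • q, by fun_prop⟩

theorem weight_mem {η : ℝ} (h0 : 0 < η) (h1 : η ≤ 1) (u : I) :
    0 ≤ η * (u * (1 - u) : ℝ) ∧ η * (u * (1 - u) : ℝ) ≤ η / 4 ∧ η * (u * (1 - u) : ℝ) ≤ 1 := by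
  have hu := u.2
  have h2 : 0 ≤ (u * (1 - u) : ℝ) := mul_nonneg hu.1 (by linarith [hu.2])
  have h3 : (u * (1 - u) : ℝ) ≤ 1 / 4 := by nlinarith [sq_nonneg ((u : ℝ) - 1 / 2)]
  refine ⟨by positivity, by nlinarith, by nlinarith⟩

theorem pull_mem_disk {η : ℝ} (h0 : 0 < η) (h1 : η ≤ 1) {q : ℝ × ℝ} (hq : q ∈ disk)
    {a : C(I, ℝ × ℝ)} (ha : ∀ u, a u ∈ disk) (u : I) : pull η q a u ∈ disk := by
  obtain ⟨w1, -, w2⟩ := weight_mem h0 h1 u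
  exact convex_disk (ha u) hq (by linarith) w1 (by ring)

theorem abs_le_two_of_mem_disk {p : ℝ × ℝ} (hp : p ∈ disk) : |p.1| ≤ 2 ∧ |p.2| ≤ 2 := by
  have hp' : p.1 ^ 2 + p.2 ^ 2 ≤ 2 := hp
  constructor <;> apply abs_le_of_sq_le_sq <;> nlinarith [sq_nonneg p.1, sq_nonneg p.2]

theorem dist_pull_le {η : ℝ} (h0 : 0 < η) (h1 : η ≤ 1) {q : ℝ × ℝ} (hq : q ∈ disk)
    {a : C(I, ℝ × ℝ)} (ha : ∀ u, a u ∈ disk) (u : I) : dist (pull η q a u) (a u) ≤ η := by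
  obtain ⟨w1, w2, -⟩ := weight_mem h0 h1 u
  have key : ∀ x y : ℝ, |x| ≤ 2 → |y| ≤ 2 →
      |(1 - η * (u * (1 - u))) * x + (η * (u * (1 - u))) * y - x| ≤ η := by
    intro x y hx hy
    rw [show (1 - η * (u * (1 - u))) * x + (η * (u * (1 - u))) * y - x =
      (η * (u * (1 - u))) * (y - x) by ring, abs_mul, abs_of_nonneg w1]
    have := abs_sub y x
    calc _ ≤ η / 4 * 4 := by gcongr; linarith
      _ = η := by ring
  have d1 := abs_le_two_of_mem_disk hq
  have d2 := abs_le_two_of_mem_disk (ha u)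
  rw [Prod.dist_eq, Real.dist_eq, Real.dist_eq]
  exact max_le (key _ _ d2.1 d1.1) (key _ _ d2.2 d1.2)

theorem exists_isRegularApprox_ofGraphs (h0 : (a 0).1 ≠ (b 0).1) (h1 : (a 1).1 ≠ (b 1).1)
    {ε : ℝ} (hε : 0 < ε) : ∃ T', (ofGraphs a b ha hb hab).IsRegularApprox T' ε := by
  obtain ⟨m, hm, hmab⟩ : ∃ m > 0, ∀ u, m ≤ dist (a u) (b u) := by
    obtain ⟨u₀, -, hu₀⟩ := isCompact_univ.exists_isMinOn (α := ℝ) (s := (univ : Set I))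
      univ_nonempty (f := fun u => dist (a u) (b u)) (by fun_prop)
    exact ⟨_, dist_pos.2 (hab u₀), fun u => hu₀ (mem_univ u)⟩
  -- Strings at distance at least `m` stay disjoint when each moves by less than `m / 2`.
  let ε' := min ε (m / 2)
  have hε' : 0 < ε' := lt_min hε (by linarith)
  let η := min (ε' / 2) 1
  have hη : 0 < η := lt_min (by linarith) one_pos
  have hη1 : η ≤ 1 := min_le_right _ _
  have hηε : η ≤ ε' / 2 := min_le_left _ _
  have hev : ∀ c : C(I, ℝ × ℝ), ∀ᶠ n in Filter.atTop,
      dist (bernsteinApproximation n c) c < ε' / 2 := fun c =>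
    (bernsteinApproximation_uniform c).eventually (Metric.ball_mem_nhds _ (by linarith))
  obtain ⟨n, hna, hnb, hn⟩ := ((hev a).and ((hev b).and (Filter.eventually_ne_atTop 0))).exists
  obtain ⟨pa, hpa⟩ := exists_polynomial_bernsteinApproximation_fst n a
  obtain ⟨pb, hpb⟩ := exists_polynomial_bernsteinApproximation_fst n b
  let D : Polynomial ℝ := (1 - Polynomial.C η * (Polynomial.X * (1 - Polynomial.X))) * (pb - pa)
  have hpa0 := hpa 0
  have hpb0 := hpb 0
  have hpa1 := hpa 1
  have hpb1 := hpb 1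
  rw [bernsteinApproximation.apply_zero] at hpa0 hpb0
  rw [bernsteinApproximation.apply_one hn] at hpa1 hpb1
  simp only [Icc.coe_zero, Icc.coe_one] at hpa0 hpb0 hpa1 hpb1
  have hD0 : D.eval 0 = (b 0).1 - (a 0).1 := by simp [D, hpa0, hpb0]
  have hD1 : D.eval 1 = (b 1).1 - (a 1).1 := by simp [D, hpa1, hpb1]
  obtain ⟨q, hq, hsimple⟩ := Polynomial.exists_sub_simple_zeros
    (by rw [hD0]; exact sub_ne_zero.2 h0.symm) hη
  have hqd : ((q, 0) : ℝ × ℝ) ∈ disk := by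
    simp only [disk, mem_ofPred_eq]
    nlinarith [hq.1, hq.2]
  have h0d : ((0, 0) : ℝ × ℝ) ∈ disk := by simp [disk]
  -- Pulling `a` towards `(q, 0)` and `b` towards the origin with the same weight stays in the
  -- convex disk, fixes the ends, and changes the horizontal distance to `D - q η X (1 - X)`.
  let a' := pull η (q, 0) (bernsteinApproximation n a)
  let b' := pull η (0, 0) (bernsteinApproximation n b)
  have hda : ∀ u, dist (a' u) (a u) < ε' := fun u =>
    ((dist_triangle _ _ _).trans_lt (add_lt_add_of_le_of_lt
      (dist_pull_le hη hη1 hqd (bernsteinApproximation_mem_disk n ha) u)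
      ((ContinuousMap.dist_apply_le_dist u).trans_lt hna))).trans_le (by linarith)
  have hdb : ∀ u, dist (b' u) (b u) < ε' := fun u =>
    ((dist_triangle _ _ _).trans_lt (add_lt_add_of_le_of_lt
      (dist_pull_le hη hη1 h0d (bernsteinApproximation_mem_disk n hb) u)
      ((ContinuousMap.dist_apply_le_dist u).trans_lt hnb))).trans_le (by linarith)
  have hab' : ∀ u, a' u ≠ b' u := by
    intro u h
    have e1 := hda u
    have e2 := hdb u
    rw [← h] at e2
    have e3 := dist_triangle_left (a u) (b u) (a' u)
    have e4 : ε' ≤ m / 2 := min_le_right _ _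
    linarith [hmab u]
  have ha0 : a' 0 = a 0 := by simp [a', pull]
  have hb0 : b' 0 = b 0 := by simp [b', pull]
  have ha1 : a' 1 = a 1 := by simp [a', pull, hn]
  have hb1 : b' 1 = b 1 := by simp [b', pull, hn]
  refine ⟨ofGraphs a' b' (pull_mem_disk hη hη1 hqd (bernsteinApproximation_mem_disk n ha))
    (pull_mem_disk hη hη1 h0d (bernsteinApproximation_mem_disk n hb)) hab',
    isZMonotone_ofGraphs, ?_, ?_, ?_, ?_, ?_, ?_⟩
  · refine isVerticallyRegular_ofGraphs
      (E := D - Polynomial.C (q * η) * (Polynomial.X * (1 - Polynomial.X))) ?_ ?_ ?_ hsimple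
    · intro u
      simp only [a', b', pull, ContinuousMap.coe_mk, Prod.fst_add, Prod.smul_fst, smul_eq_mul,
        hpa, hpb, D, Polynomial.eval_sub, Polynomial.eval_mul, Polynomial.eval_C,
        Polynomial.eval_X, Polynomial.eval_one]
      ring
    · simpa [hD0, sub_eq_zero] using h0.symm
    · simpa [hD1, sub_eq_zero] using h1.symm
  · simp only [ofGraphs, graphString, ContinuousMap.coe_mk, ha0]
  · simp only [ofGraphs, graphString, ContinuousMap.coe_mk, ha1]
  · simp only [ofGraphs, graphString, ContinuousMap.coe_mk, hb0]
  · simp only [ofGraphs, graphString, ContinuousMap.coe_mk, hb1]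
  · intro z hz
    simp only [ofGraphs]
    rw [atHeight_graphString a' hz, atHeight_graphString a hz, atHeight_graphString b' hz,
      atHeight_graphString b hz]
    exact ⟨(hda _).trans_le (min_le_left _ _), (hdb _).trans_le (min_le_left _ _)⟩

/-- The linking index of a tangle parametrized by height. -/
theorem hasLinkingIndex_ofGraphs (h0 : (a 0).1 ≠ (b 0).1) (h1 : (a 1).1 ≠ (b 1).1) {h : ℝ → ℂ}
    (hc : ContinuousOn h (Icc 0 1)) (he : ∀ u : I,
      (⟨(b u).1 - (a u).1, (b u).2 - (a u).2⟩ : ℂ) = Complex.exp (h u)) :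
    (ofGraphs a b ha hb hab).HasLinkingIndex
      ((1 / 2) * ((halfTurns (h 1).im - halfTurns (h 0).im : ℤ) : ℚ)) := by
  have key := hasLinkingIndex_of_log (T := ofGraphs a b ha hb hab) (h := fun z => h (z / 3))
    isZMonotone_ofGraphs (by simp [ofGraphs, graphString]) (by simp [ofGraphs, graphString])
    (by simp [ofGraphs, graphString]) (by simp [ofGraphs, graphString])
    (fun ε hε => exists_isRegularApprox_ofGraphs h0 h1 hε)
    (hc.comp (by fun_prop) fun z hz => ⟨by linarith [hz.1], by linarith [hz.2]⟩)
    (fun z hz => by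
      have hu : z / 3 ∈ I := ⟨by linarith [hz.1], by linarith [hz.2]⟩
      simp only [gap, ofGraphs]
      rw [atHeight_graphString a hz, atHeight_graphString b hz, he, projIcc_of_mem zero_le_one hu])
  simpa using key

end Tangle

/-! ### The tangle over a shadow -/

theorem exists_homeomorph_of_strictMono {t : ℝ → ℝ} (ht : StrictMono t)
    (hc : ContinuousOn t (Icc 0 1)) (h0 : t 0 = 0) (h1 : t 1 = 1) :
    ∃ φ : I ≃ₜ I, φ 0 = 0 ∧ φ 1 = 1 ∧ ∀ u : I, (φ u : ℝ) = t u := by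
  have hmem : ∀ u : I, t u ∈ Icc (0 : ℝ) 1 := fun u =>
    ⟨h0 ▸ ht.monotone u.2.1, h1 ▸ ht.monotone u.2.2⟩
  let f : I → I := fun u => ⟨t u, hmem u⟩
  have hf : StrictMono f := fun u v huv => ht huv
  have hsurj : Function.Surjective f := by
    intro v
    obtain ⟨u, hu, huv⟩ := intermediate_value_Icc zero_le_one hc
      (show (v : ℝ) ∈ Icc (t 0) (t 1) by rw [h0, h1]; exact v.2)
    exact ⟨⟨u, hu⟩, Subtype.ext huv⟩
  refine ⟨(hf.orderIsoOfSurjective f hsurj).toHomeomorph, ?_, ?_, fun u => rfl⟩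
  · exact Subtype.ext h0
  · exact Subtype.ext h1

/-- A gap pointing to the right has principal argument within `π / 2` of zero, so its number of half
turns is even and counts full turns. -/
theorem halfTurns_im_of_exp_eq {w f : ℂ} (h : f = Complex.exp w) (hf : 0 < f.re) :
    ∃ m : ℤ, w.im = f.arg + 2 * Real.pi * m ∧ halfTurns w.im = 2 * m := by
  have hf0 : f ≠ 0 := h ▸ Complex.exp_ne_zero w
  obtain ⟨m, hm⟩ := Complex.exp_eq_exp_iff_exists_int.1 (h.symm.trans (Complex.exp_log hf0).symm)
  have him : w.im = f.arg + 2 * Real.pi * m := by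
    rw [hm]
    simp only [Complex.add_im, Complex.log_im]
    simp
    ring
  refine ⟨m, him, ?_⟩
  rw [him, halfTurns_add_two_pi_mul,
    halfTurns_eq_zero_of_abs_lt (Complex.abs_arg_lt_pi_div_two_iff.2 (Or.inl hf)), zero_add]

/-- The corner `q` is the rightmost point of the disk at its height, so the vector from another
point of the disk to `q` cannot point straight to the left. -/
theorem sub_mem_slitPlane_of_mem_disk {p q : ℝ × ℝ} (hp : p ∈ disk) (hpq : p ≠ q)
    (h1 : q.1 = 1) (h2 : q.2 ^ 2 = 1) :
    (⟨q.1 - p.1, q.2 - p.2⟩ : ℂ) ∈ Complex.slitPlane := by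
  rw [Complex.mem_slitPlane_iff]
  by_contra! hc
  obtain ⟨hc1, hc2⟩ := hc
  simp only at hc1 hc2
  have h3 : p.2 = q.2 := by linarith
  have hp' : p.1 ^ 2 + p.2 ^ 2 ≤ 2 := hp
  rw [h3, h2] at hp'
  exact hpq (Prod.ext (by nlinarith) h3)

theorem sub_mem_slitPlane_of_mem_disk' {p q : ℝ × ℝ} (hp : p ∈ disk) (hpq : p ≠ q)
    (h1 : q.1 = -1) (h2 : q.2 ^ 2 = 1) :
    (⟨p.1 - q.1, p.2 - q.2⟩ : ℂ) ∈ Complex.slitPlane := by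
  rw [Complex.mem_slitPlane_iff]
  by_contra! hc
  obtain ⟨hc1, hc2⟩ := hc
  simp only at hc1 hc2
  have h3 : p.2 = q.2 := by linarith
  have hp' : p.1 ^ 2 + p.2 ^ 2 ≤ 2 := hp
  rw [h3, h2] at hp'
  exact hpq (Prod.ext (by nlinarith) h3)

/-- The tangle over a shadow `U` whose arcs have `2 k` common points in the same order, when `R` is
traversed by means of the affine parameter change `r`. -/
theorem TangleShadow.exists_tangle (U : TangleShadow) {r : ℝ → ℝ} {e : ℝ} (he : e ≠ 0)
    (hr : ∀ x, HasDerivAt r e x) (hrI : ∀ x ∈ Icc (0 : ℝ) 1, r x ∈ Icc (0 : ℝ) 1)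
    (hinj : Function.Injective r) (hrint : ∀ x, r x ∈ Ioo (0 : ℝ) 1 → x ∈ Ioo (0 : ℝ) 1)
    (hR0 : (U.R (r 0)).1 = 1) (hR1 : (U.R (r 1)).1 = 1) (hR1' : (U.R (r 1)).2 ^ 2 = 1)
    {k : ℕ} {t s : Fin (2 * k) → ℝ} (ht : ∀ i, t i ∈ Icc (0 : ℝ) 1)
    (hs : ∀ i, s i ∈ Icc (0 : ℝ) 1) (hts : ∀ i, U.L (t i) = U.R (r (s i))) (htm : StrictMono t)
    (hsm : StrictMono s) :
    ∃ T : Tangle, T.IsZMonotone ∧ (∃ n : ℤ, |n| = k ∧ T.HasLinkingIndex n) ∧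
      ∃ φ ψ : I ≃ₜ I, φ 0 = 0 ∧ φ 1 = 1 ∧ ψ 0 = 0 ∧ ψ 1 = 1 ∧
        (∀ u : I, T.lam u = (U.L (φ u), 3 * (u : ℝ))) ∧
        ∀ u : I, T.rho u = (U.R (r (ψ u)), 3 * (u : ℝ)) := by
  classical
  let toC : ℝ × ℝ → ℂ := fun p => ⟨p.1, p.2⟩
  have htoC : toC = Complex.equivRealProdCLM.symm := by
    ext1 p
    apply Complex.ext <;> simp [toC]
  have htoC_inj : ∀ p q, toC p = toC q → p = q := fun p q h =>
    Prod.ext (congrArg Complex.re h) (congrArg Complex.im h)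
  have hLd : ∀ x u, HasDerivAt U.L u x → HasDerivAt (fun x => toC (U.L x)) (toC u) x := by
    intro x u h
    rw [htoC]
    exact Complex.equivRealProdCLM.symm.hasFDerivAt.comp_hasDerivAt x h
  have hRd : ∀ x u, HasDerivAt U.R u (r x) →
      HasDerivAt (fun x => toC (U.R (r x))) (toC (e • u)) x := by
    intro x u h
    rw [htoC]
    exact Complex.equivRealProdCLM.symm.hasFDerivAt.comp_hasDerivAt x (h.scomp x (hr x))
  have hrc : Continuous r := continuous_iff_continuousAt.2 fun x => (hr x).continuousAt
  have hLc : ContinuousOn (fun x => toC (U.L x)) (Icc 0 1) := by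
    rw [htoC]
    exact Complex.equivRealProdCLM.symm.continuous.comp_continuousOn U.continuousOn_L
  have hRr : ContinuousOn (fun x => U.R (r x)) (Icc 0 1) :=
    U.continuousOn_R.comp hrc.continuousOn hrI
  have hRc : ContinuousOn (fun x => toC (U.R (r x))) (Icc 0 1) := by
    rw [htoC]
    exact Complex.equivRealProdCLM.symm.continuous.comp_continuousOn hRr
  have hdouble : ∀ q ∈ unitSquare, toC (U.R (r q.2)) = toC (U.L q.1) →
      ((false, q.1), (true, r q.2)) ∈ doublePoints U.L U.R := fun q hq h =>
    ⟨hq.1, hrI _ hq.2, by simp, by simpa [arcPair] using (htoC_inj _ _ h).symm⟩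
  have hswap : ∀ a b, (a, b) ∈ doublePoints U.L U.R → (b, a) ∈ doublePoints U.L U.R :=
    fun a b h => ⟨h.2.1, h.1, h.2.2.1.symm, h.2.2.2.symm⟩
  have hfin : {q ∈ unitSquare | toC (U.R (r q.2)) = toC (U.L q.1)}.Finite := by
    refine (U.finite_doublePoints.preimage (f := fun q : ℝ × ℝ => ((false, q.1), (true, r q.2)))
      fun q _ q' _ h => ?_).subset fun q hq => hdouble q hq.1 hq.2
    simp only [Prod.mk.injEq, true_and] at h
    exact Prod.ext h.1 (hinj h.2)
  have hint : ∀ q ∈ unitSquare, toC (U.R (r q.2)) = toC (U.L q.1) →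
      q.1 ∈ Ioo (0 : ℝ) 1 ∧ q.2 ∈ Ioo (0 : ℝ) 1 := fun q hq h =>
    ⟨U.interior _ _ (hdouble q hq h), hrint _ (U.interior _ _ (hswap _ _ (hdouble q hq h)))⟩
  have h0I : (0 : ℝ) ∈ Icc (0 : ℝ) 1 := by simp
  have h1I : (1 : ℝ) ∈ Icc (0 : ℝ) 1 := by simp
  have hL0 : (U.L 0).1 = -1 := by rw [U.L_zero]
  have hL1 : (U.L 1).1 = -1 := by rw [U.L_one]
  let C : Finset (ℝ × ℝ) := Finset.univ.image fun i => (t i, s i)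
  have hCcard : C.card = 2 * k := by
    rw [Finset.card_image_of_injective _ fun i j h => htm.injective (congrArg Prod.fst h),
      Finset.card_fin]
  obtain ⟨S, t', s', hpath, ht', hs', h, n, hc, hexp, hn, hvar⟩ := exists_paths_winding hLc hRc
    hfin.toFinset (fun q hq => by
      rw [hfin.mem_toFinset]
      exact (and_iff_right hq).symm)
    (fun p hp => by
      obtain ⟨h1, h2⟩ := hfin.mem_toFinset.1 hp
      obtain ⟨h3, h4⟩ := hint p h1 h2
      exact ⟨h3.1, h3.2, h4.1, h4.2⟩)
    (fun p hp => by
      obtain ⟨h1, h2⟩ := hfin.mem_toFinset.1 hp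
      obtain ⟨u, v, hu, hv, huv⟩ := U.transverse _ _ (hdouble p h1 h2)
      refine ⟨_, _, hLd _ u (by simpa [arcPair] using hu), hRd _ v (by simpa [arcPair] using hv), ?_⟩
      simp only [toC, Prod.smul_fst, Prod.smul_snd, smul_eq_mul]
      rw [show u.1 * (e * v.2) - u.2 * (e * v.1) = e * (u.1 * v.2 - u.2 * v.1) by ring]
      exact mul_ne_zero he huv)
    (fun x hx => by
      refine sub_mem_slitPlane_of_mem_disk' (U.R_mem _ (hrI x hx)) (fun h => ?_) hL0
        (by rw [U.L_zero]; norm_num)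
      exact lt_irrefl _ (hint (0, x) ⟨h0I, hx⟩ (congrArg toC h)).1.1)
    (fun x hx => by
      refine sub_mem_slitPlane_of_mem_disk (U.L_mem x hx) (fun h => ?_) hR1 hR1'
      exact lt_irrefl _ (hint (x, 1) ⟨hx, h1I⟩ (congrArg toC h.symm)).2.2)
    C (by
      intro p hp
      obtain ⟨i, -, rfl⟩ := Finset.mem_image.1 hp
      exact hfin.mem_toFinset.2 ⟨⟨ht i, hs i⟩, congrArg toC (hts i).symm⟩)
    (by
      intro p hp q hq hpq
      obtain ⟨i, -, rfl⟩ := Finset.mem_image.1 hp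
      obtain ⟨j, -, rfl⟩ := Finset.mem_image.1 hq
      rcases lt_trichotomy i j with hij | hij | hij
      · exact Or.inl ⟨htm hij, hsm hij⟩
      · exact absurd (by rw [hij]) hpq
      · exact Or.inr ⟨htm hij, hsm hij⟩)
    k hCcard
  obtain ⟨t0, s0⟩ := Prod.mk.inj hpath.apply_zero
  obtain ⟨t1, s1⟩ := Prod.mk.inj hpath.apply_one
  obtain ⟨φ, hφ0, hφ1, hφ⟩ := exists_homeomorph_of_strictMono ht' hpath.continuousOn_fst t0 t1
  obtain ⟨ψ, hψ0, hψ1, hψ⟩ := exists_homeomorph_of_strictMono hs' hpath.continuousOn_snd s0 s1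
  let a : C(I, ℝ × ℝ) := ⟨fun u => U.L (φ u), U.continuousOn_L.comp_continuous
    (by fun_prop) fun u => (φ u).2⟩
  let b : C(I, ℝ × ℝ) := ⟨fun u => U.R (r (ψ u)), hRr.comp_continuous
    (by fun_prop) fun u => (ψ u).2⟩
  have hgap : ∀ u : I, (⟨(b u).1 - (a u).1, (b u).2 - (a u).2⟩ : ℂ) = Complex.exp (h u) := by
    intro u
    rw [← hexp u u.2, ← hφ, ← hψ]
    rfl
  have hab : ∀ u, a u ≠ b u := by
    intro u hu
    refine Complex.exp_ne_zero (h u) ?_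
    rw [← hgap u, hu, sub_self, sub_self]
    rfl
  have hre : ∀ u : I, (a u).1 = -1 → (b u).1 = 1 →
      0 < (⟨(b u).1 - (a u).1, (b u).2 - (a u).2⟩ : ℂ).re := by
    intro u h1 h2
    simp only [h1, h2]
    norm_num
  have ha0 : a 0 = U.L 0 := by simp [a, hφ0]
  have ha1 : a 1 = U.L 1 := by simp [a, hφ1]
  have hb0 : b 0 = U.R (r 0) := by simp [b, hψ0]
  have hb1 : b 1 = U.R (r 1) := by simp [b, hψ1]
  obtain ⟨m₀, him₀, hm₀⟩ := halfTurns_im_of_exp_eq (hgap 0)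
    (hre 0 (by rw [ha0, hL0]) (by rw [hb0, hR0]))
  obtain ⟨m₁, him₁, hm₁⟩ := halfTurns_im_of_exp_eq (hgap 1)
    (hre 1 (by rw [ha1, hL1]) (by rw [hb1, hR1]))
  have hm : m₁ - m₀ = n := by
    simp only [Icc.coe_zero, Icc.coe_one] at him₀ him₁
    rw [him₀, him₁, ha0, ha1, hb0, hb1] at hvar
    have e : 2 * Real.pi * ((m₁ - m₀ : ℤ) : ℝ) = 2 * Real.pi * (n : ℝ) := by
      have e0 : toC (U.R (r 0)) - toC (U.L 0) =
        ⟨(U.R (r 0)).1 - (U.L 0).1, (U.R (r 0)).2 - (U.L 0).2⟩ := rfl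
      have e1 : toC (U.R (r 1)) - toC (U.L 1) =
        ⟨(U.R (r 1)).1 - (U.L 1).1, (U.R (r 1)).2 - (U.L 1).2⟩ := rfl
      rw [e0, e1] at hvar
      push_cast
      linarith
    exact_mod_cast mul_left_cancel₀ (by positivity) e
  have hlk := Tangle.hasLinkingIndex_ofGraphs (a := a) (b := b)
    (ha := fun u => U.L_mem _ (φ u).2) (hb := fun u => U.R_mem _ (hrI _ (ψ u).2)) (hab := hab)
    (by rw [ha0, hb0, hL0, hR0]; norm_num) (by rw [ha1, hb1, hL1, hR1]; norm_num) hc hgap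
  refine ⟨Tangle.ofGraphs a b (fun u => U.L_mem _ (φ u).2) (fun u => U.R_mem _ (hrI _ (ψ u).2)) hab,
    Tangle.isZMonotone_ofGraphs, ⟨n, hn, ?_⟩, φ, ψ, hφ0, hφ1, hψ0, hψ1,
    fun u => rfl, fun u => rfl⟩
  convert hlk using 1
  simp only [Icc.coe_zero, Icc.coe_one] at hm₀ hm₁
  rw [hm₀, hm₁, ← hm]
  push_cast
  ring

end

/-! ### The two types of tangle -/

theorem mainTheorem7 (U : TangleShadow) (m : ℕ) (hm : 2 ≤ m) (heven : Even m) :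
    (U.HasRank m → ∃ T : Tangle, T.IsZMonotone ∧ T.IsTypeI ∧ U.IsShadowOf T ∧
      ∃ k : ℚ, T.HasLinkingIndex k ∧ |k| = (m : ℚ) / 2) ∧
    (U.HasNegRank m → ∃ T : Tangle, T.IsZMonotone ∧ T.IsTypeII ∧ U.IsShadowOf T ∧
      ∃ k : ℚ, T.HasLinkingIndex k ∧ |k| = (m : ℚ) / 2) := by
  obtain ⟨k, rfl⟩ := heven.two_dvd
  have habs : ∀ n : ℤ, |n| = k → |(n : ℚ)| = ((2 * k : ℕ) : ℚ) / 2 := by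
    intro n hn
    rw [← Int.cast_abs, hn]
    push_cast
    ring
  constructor
  · rintro ⟨t, s, ht, hs, hts, htm, hsm⟩
    obtain ⟨T, hT, ⟨n, hn, hlk⟩, φ, ψ, hφ0, hφ1, hψ0, hψ1, hlam, hrho⟩ := U.exists_tangle
      (r := id) one_ne_zero hasDerivAt_id (fun x hx => hx) Function.injective_id (fun x hx => hx)
      (by simp [U.R_zero]) (by simp [U.R_one]) (by simp [U.R_one]) ht hs hts htm hsm
    refine ⟨T, hT, ⟨?_, ?_, ?_, ?_⟩, ⟨⟨φ, fun u => by rw [hlam]⟩, ψ, fun u => by rw [hrho]; rfl⟩,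
      n, hlk, habs n hn⟩
    · simp [hlam, hφ0, U.L_zero]
    · simp [hlam, hφ1, U.L_one]
    · simp [hrho, hψ0, U.R_zero]
    · simp [hrho, hψ1, U.R_one]
  · rintro ⟨t, s, ht, hs, hts, htm, hsm⟩
    obtain ⟨T, hT, ⟨n, hn, hlk⟩, φ, ψ, hφ0, hφ1, hψ0, hψ1, hlam, hrho⟩ := U.exists_tangle
      -- Traversing `R` backwards turns the reversed order of the crossings into the same order, and
      -- puts the string over `R` in Type II position.
      (r := fun x => 1 - x) (e := -1) (by norm_num) (fun x => (hasDerivAt_id x).const_sub 1)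
      (fun x hx => ⟨by linarith [hx.2], by linarith [hx.1]⟩) sub_right_injective
      (fun x hx => ⟨by linarith [hx.2], by linarith [hx.1]⟩)
      (by simp [U.R_one]) (by simp [U.R_zero]) (by simp [U.R_zero]) ht
      (s := fun i => 1 - s i) (fun i => ⟨by linarith [(hs i).2], by linarith [(hs i).1]⟩)
      (fun i => by rw [hts i, sub_sub_cancel]) htm (fun i j hij => by linarith [hsm hij])
    refine ⟨T, hT, ⟨?_, ?_, ?_, ?_⟩, ⟨⟨φ, fun u => by rw [hlam]⟩,
      ψ.trans unitInterval.symmHomeomorph, fun u => by rw [hrho]; rfl⟩, n, hlk, habs n hn⟩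
    · simp [hlam, hφ0, U.L_zero]
    · simp [hlam, hφ1, U.L_one]
    · simp [hrho, hψ0, U.R_one]
    · simp [hrho, hψ1, U.R_zero]
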